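/- Let $p\in\{0,1,2\}$, let $\langle\cdot,\cdot\rangle_p=-\sum_{i\le p}dx_i^2+\sum_{i>p}dx_i^2$ on $\mathbb R^3$, and let $\mathbb S^2_p=\{x\in\mathbb R^3:\langle x,x\rangle_p=1\}$ with induced metric $g$, (para-)complex structure $j_x(v)=-I_p(x\times v)$, where $I_p$ is the diagonal matrix of $\langle\cdot,\cdot\rangle_p$, and 2-form $\omega=g(j\cdot,\cdot)$. On $\mathbb S^2_p\times\mathbb S^2_p$ consider the neutral metric $G=(g,-g)$, the structures $J_1=j\oplus j$, $J_2=j\oplus(-j)$, and the forms $\Omega_1=\pi_1^*\omega-\pi_2^*\omega$, $\Omega_2=\pi_1^*\omega+\pi_2^*\omega$. Let $F:\Sigma\to\mathbb S^2_p\times\mathbb S^2_p$ be a smooth $G$-minimal immersion (zero mean curvature vector) of an oriented surface whose induced metric $F^*G$ is Riemannian ($\epsilon=1$) or Lorentzian ($\epsilon=-1$). Let $\omega_\Sigma$ be the area form of $F^*G$, with $\omega_\Sigma(e_1,e_2)=\epsilon$ on oriented orthonormal frames with $|e_1|^2=\epsilon|e_2|^2=1$, and define the Kähler functions $C_1,C_2$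 on $\Sigma$ by $F^*\Omega_k=C_k\,\omega_\Sigma$. On an open subset of $\Sigma$ let $(e_1,e_2)$ be an oriented orthonormal tangent frame as above and $(N,\tilde N)$ a smooth orthonormal frame of the normal bundle of $F$ in $(\mathbb S^2_p\times\mathbb S^2_p,G)$ with $|N|^2=\epsilon|\tilde N|^2=-\epsilon b$, $b\in\{-1,1\}$, ordered so that, with $i^2=-\epsilon$, $Z=\tfrac12(dF(e_1)-\epsilon i\,dF(e_2))$ and $\xi=(N-i\epsilon\tilde N)/\sqrt2$, \[ J_1Z=iC_1Z+\epsilon\gamma_1\xi,\qquad J_2Z=iC_2Z+\epsilon\gamma_2\bar\xi \] for some (para-)complex functions $\gamma_1,\gamma_2$. Let $K^\perp=G(R^\perp(e_1,e_2)\tilde N,N)$, where $R^\perp$ is the curvature of the normal connection, and let $K=F^*G(R(e_1,e_2)e_2,e_1)$, where $R$ is the curvature tensor of $F^*G$ (so $K$ is $\epsilon$ times the Gauss curvature of $F^*G$). Then for $j=1,2$ and $j'=3-j$, on this open subset, \[ |\nabla C_j|^2=\bigl(\epsilon C_j^2+(-1)^{p+1}\bigr)\bigl(K+\epsilon b(-1)^{j+1}K^\perp+(-1)^{p+1}C_jC_{j'}\bigr),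 \] \[ \Delta C_j=2\epsilon C_j\bigl(K+\epsilon b(-1)^{j+1}K^\perp\bigr)-C_{j'}\bigl(1-\epsilon(-1)^{p+1}C_j^2\bigr), \] where $\nabla$ and $\Delta$ are the gradient and the Laplacian of $F^*G$. -/

import Mathlib

open scoped Manifold ContDiff

noncomputable section

namespace NeutralProduct

/-- The vector space `ℝ³`. -/
abbrev R3 : Type := Fin 3 → ℝ

/-- The ambient vector space `ℝ³ × ℝ³`. -/
abbrev Amb : Type := R3 × R3

/-- Local coordinates on a surface. -/
abbrev Coord : Type := EuclideanSpace ℝ (Fin 2)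

/-! ### The ambient space -/

/-- Diagonal of the scalar product of signature `(p, 3 - p)`: the first `p` entries are `-1`. -/
def eta (p : ℕ) (i : Fin 3) : ℝ := if (i : ℕ) < p then -1 else 1

/-- The scalar product `⟨u, v⟩_p` on `ℝ³`. -/
def ip (p : ℕ) (u v : R3) : ℝ := ∑ i, eta p i * (u i * v i)

/-- The quadric `{x | ⟨x, x⟩_p = 1}`. -/
def quadric (p : ℕ) : Set R3 := {x | ip p x x = 1}

/-- The (para-)complex structure `j_x v = - I_p (x × v)` of the quadric, where
`I_p = diag (eta p)`. -/
def jmap (p : ℕ) (x v : R3) : R3 := fun i => -(eta p i * (crossProduct x v) i)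

/-- The 2-form `ω = g(j ·, ·)` of the quadric at `x`. -/
def omega (p : ℕ) (x u v : R3) : ℝ := ip p (jmap p x u) v

/-- The neutral metric `G = (g, -g)`, extended to the ambient vector space. -/
def G (p : ℕ) (V W : Amb) : ℝ := ip p V.1 W.1 - ip p V.2 W.2

/-- `J_1 = j ⊕ j` (index `0`) and `J_2 = j ⊕ (-j)` (index `1`). -/
def J (p : ℕ) (k : Fin 2) (x V : Amb) : Amb :=
  (jmap p x.1 V.1, (-1 : ℝ) ^ (k : ℕ) • jmap p x.2 V.2)

/-- `Ω_1 = π₁*ω - π₂*ω` (index `0`) and `Ω_2 = π₁*ω + π₂*ω` (index `1`). -/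
def Om (p : ℕ) (k : Fin 2) (x V W : Amb) : ℝ :=
  omega p x.1 V.1 W.1 - (-1 : ℝ) ^ (k : ℕ) * omega p x.2 V.2 W.2

/-! ### Geometry of a coordinate patch `X : Coord → Amb` with values in the product of quadrics -/

/-- The `i`-th partial derivative. -/
def pd {E : Type} [NormedAddCommGroup E] [NormedSpace ℝ E] (i : Fin 2) (f : Coord → E)
    (x : Coord) : E := fderiv ℝ f x (EuclideanSpace.single i 1)

/-- The induced metric on tangent vectors, which are given by their coordinates. -/
def gForm (p : ℕ) (X : Coord → Amb) (x a b : Coord) : ℝ :=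
  G p (fderiv ℝ X x a) (fderiv ℝ X x b)

/-- The matrix `g_{ij}` of the induced metric. -/
def gram (p : ℕ) (X : Coord → Amb) (x : Coord) : Matrix (Fin 2) (Fin 2) ℝ :=
  Matrix.of fun i j => G p (pd i X x) (pd j X x)

/-- The coordinate area of the parallelogram spanned by two tangent vectors. -/
def coordDet (a b : Coord) : ℝ := a 0 * b 1 - a 1 * b 0

/-- `(a, b)` is a positively oriented orthonormal frame of the induced metric:
`|a|² = ε |b|² = 1`. -/
def IsOrientedFrame (p : ℕ) (ε : ℝ) (X : Coord → Amb) (x a b : Coord) : Prop :=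
  gForm p X x a a = 1 ∧ gForm p X x a b = 0 ∧ gForm p X x b b = ε ∧ 0 < coordDet a b

/-- The area form `ω_Σ = F*G(ȷ ·, ·)`, with `ȷ e₁ = e₂`, `ȷ e₂ = -ε e₁` for an oriented orthonormal
frame; so its value on such a frame is `ε`. -/
def areaForm (p : ℕ) (ε : ℝ) (X : Coord → Amb) (x a b : Coord) : ℝ :=
  ε * (Real.sqrt |(gram p X x).det| * coordDet a b)

/-- Components of the gradient, `(∇f)^i = g^{ij} ∂_j f`. -/
def grad (p : ℕ) (X : Coord → Amb) (f : Coord → ℝ) (x : Coord) (i : Fin 2) : ℝ :=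
  ∑ j, (gram p X x)⁻¹ i j * pd j f x

/-- `|∇f|² = g(∇f, ∇f)`. -/
def gradNormSq (p : ℕ) (X : Coord → Amb) (f : Coord → ℝ) (x : Coord) : ℝ :=
  ∑ i, ∑ j, gram p X x i j * grad p X f x i * grad p X f x j

/-- The Laplacian (divergence of the gradient) of the induced metric. -/
def laplacian (p : ℕ) (X : Coord → Amb) (f : Coord → ℝ) (x : Coord) : ℝ :=
  (Real.sqrt |(gram p X x).det|)⁻¹ *
    ∑ i, pd i (fun y => Real.sqrt |(gram p X y).det| * grad p X f y i) x

/-- The Christoffel symbols `Γ^k_{ij}` of the induced metric. -/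
def christoffel (p : ℕ) (X : Coord → Amb) (k i j : Fin 2) (x : Coord) : ℝ :=
  (1 / 2) * ∑ l, (gram p X x)⁻¹ k l *
    (pd i (fun y => gram p X y j l) x + pd j (fun y => gram p X y i l) x
      - pd l (fun y => gram p X y i j) x)

/-- The component along `∂_l` of `R(∂_i, ∂_j) ∂_k`, with
`R(U, V) = ∇_U ∇_V - ∇_V ∇_U - ∇_{[U, V]}`. -/
def riemann (p : ℕ) (X : Coord → Amb) (i j k l : Fin 2) (x : Coord) : ℝ :=
  pd i (christoffel p X l j k) x - pd j (christoffel p X l i k) x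
    + ∑ m, (christoffel p X l i m x * christoffel p X m j k x
      - christoffel p X l j m x * christoffel p X m i k x)

/-- The Gauss curvature `g(R(∂₁, ∂₂) ∂₂, ∂₁) / det g` of the induced metric. -/
def gaussCurvature (p : ℕ) (X : Coord → Amb) (x : Coord) : ℝ :=
  (∑ l, riemann p X 0 1 1 l x * gram p X x l 0) / (gram p X x).det

/-- The orthogonal projection of `ℝ³ × ℝ³` onto the tangent space of the product of quadrics at
`x`. -/
def ambTangent (p : ℕ) (x W : Amb) : Amb :=
  (W.1 - ip p W.1 x.1 • x.1, W.2 - ip p W.2 x.2 • x.2)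

/-- The projection of `ℝ³ × ℝ³` onto the normal space of the patch within the product of
quadrics. -/
def normalPart (p : ℕ) (X : Coord → Amb) (x : Coord) (W : Amb) : Amb :=
  ambTangent p (X x) W
    - ∑ i, ∑ j, ((gram p X x)⁻¹ i j * G p W (pd i X x)) • pd j X x

/-- The second fundamental form `h(∂_i, ∂_j)`. -/
def secondFF (p : ℕ) (X : Coord → Amb) (i j : Fin 2) (x : Coord) : Amb :=
  normalPart p X x (pd i (pd j X) x)

/-- The mean curvature vector `H = (1/2) g^{ij} h(∂_i, ∂_j)`. -/
def meanCurvature (p : ℕ) (X : Coord → Amb) (x : Coord) : Amb :=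
  (1 / 2 : ℝ) • ∑ i, ∑ j, (gram p X x)⁻¹ i j • secondFF p X i j x

/-- The normal connection `∇^⊥_{∂_i} ν`. -/
def normalConn (p : ℕ) (X : Coord → Amb) (i : Fin 2) (ν : Coord → Amb) (x : Coord) : Amb :=
  normalPart p X x (pd i ν x)

/-- `R^⊥(∂₁, ∂₂) ν`, the curvature of the normal connection. -/
def normalCurvTensor (p : ℕ) (X : Coord → Amb) (ν : Coord → Amb) (x : Coord) : Amb :=
  normalConn p X 0 (normalConn p X 1 ν) x - normalConn p X 1 (normalConn p X 0 ν) x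

/-- The curvature `K^⊥ = R^⊥(e₁, e₂, v₂, v₁) = G(R^⊥(e₁, e₂) v₂, v₁)` of the normal bundle. -/
def normalCurvature (p : ℕ) (X : Coord → Amb) (e₁ e₂ : Coord → Coord) (v₁ v₂ : Coord → Amb)
    (x : Coord) : ℝ :=
  coordDet (e₁ x) (e₂ x) * G p (normalCurvTensor p X v₂ x) (v₁ x)

/-! ### (Para-)complex vectors

With `i² = -ε`, a (para-)complex number `r + i s` is the pair `(r, s)`, and a (para-)complex vector
`A + i B` is the pair `(A, B)`. -/

/-- `(r + i s) (A + i B)` with `i² = -ε`. -/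
def pcSmul (ε : ℝ) (c : ℝ × ℝ) (Z : Amb × Amb) : Amb × Amb :=
  (c.1 • Z.1 - (ε * c.2) • Z.2, c.1 • Z.2 + c.2 • Z.1)

/-- The conjugate of a (para-)complex vector. -/
def pcConj (Z : Amb × Amb) : Amb × Amb := (Z.1, -Z.2)

/-- `J_k`, extended (para-)complex linearly. -/
def pcJ (p : ℕ) (k : Fin 2) (x : Amb) (Z : Amb × Amb) : Amb × Amb := (J p k x Z.1, J p k x Z.2)

/-- `(A - i ε B) / 2`; for `A = F_x`, `B = F_y` this is `F_z`, `z = x + i y`. -/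
def pcTangent (ε : ℝ) (A B : Amb) : Amb × Amb := (1 / 2 : ℝ) • (A, -(ε • B))

/-- `ξ = (N - i ε Ñ) / √2`. -/
def pcNormal (ε : ℝ) (N N' : Amb) : Amb × Amb := (Real.sqrt 2)⁻¹ • (N, -(ε • N'))

/-- The local frames used for a minimal patch `X` with Kähler functions `C`, over the coordinate
domain `W`: an oriented orthonormal tangent frame `(e₁, e₂)` and an orthonormal frame `(N, N')`
of the normal bundle with `|N|² = ε |N'|² = -ε b`. The frame of the normal bundle is ordered so
that, with `Z = (e₁ - i ε e₂) / 2` and `ξ = (N - i ε N') / √2`,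
`J_1 Z = i C_1 Z + ε γ_1 ξ` and `J_2 Z = i C_2 Z + ε γ_2 ξ̄` for (para-)complex `γ_1`, `γ_2`. -/
structure IsAdaptedFrame (p : ℕ) (ε b : ℝ) (X : Coord → Amb) (C : Fin 2 → Coord → ℝ)
    (W : Set Coord) (e₁ e₂ : Coord → Coord) (N N' : Coord → Amb) : Prop where
  smooth_e₁ : ContDiffOn ℝ ∞ e₁ W
  smooth_e₂ : ContDiffOn ℝ ∞ e₂ W
  smooth_N : ContDiffOn ℝ ∞ N W
  smooth_N' : ContDiffOn ℝ ∞ N' W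
  oriented : ∀ x ∈ W, IsOrientedFrame p ε X x (e₁ x) (e₂ x)
  ambient_N : ∀ x ∈ W, ip p (N x).1 (X x).1 = 0 ∧ ip p (N x).2 (X x).2 = 0
  ambient_N' : ∀ x ∈ W, ip p (N' x).1 (X x).1 = 0 ∧ ip p (N' x).2 (X x).2 = 0
  normal_N : ∀ x ∈ W, ∀ a : Coord, G p (fderiv ℝ X x a) (N x) = 0
  normal_N' : ∀ x ∈ W, ∀ a : Coord, G p (fderiv ℝ X x a) (N' x) = 0
  norm_N : ∀ x ∈ W, G p (N x) (N x) = -(ε * b)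
  norm_N' : ∀ x ∈ W, ε * G p (N' x) (N' x) = -(ε * b)
  orthogonal : ∀ x ∈ W, G p (N x) (N' x) = 0
  J_one : ∀ x ∈ W, ∃ γ : ℝ × ℝ,
    pcJ p 0 (X x) (pcTangent ε (fderiv ℝ X x (e₁ x)) (fderiv ℝ X x (e₂ x))) =
      pcSmul ε (0, C 0 x) (pcTangent ε (fderiv ℝ X x (e₁ x)) (fderiv ℝ X x (e₂ x)))
        + ε • pcSmul ε γ (pcNormal ε (N x) (N' x))
  J_two : ∀ x ∈ W, ∃ γ : ℝ × ℝ,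
    pcJ p 1 (X x) (pcTangent ε (fderiv ℝ X x (e₁ x)) (fderiv ℝ X x (e₂ x))) =
      pcSmul ε (0, C 1 x) (pcTangent ε (fderiv ℝ X x (e₁ x)) (fderiv ℝ X x (e₂ x)))
        + ε • pcSmul ε γ (pcConj (pcNormal ε (N x) (N' x)))

/-! ### Immersed oriented surfaces -/

/-- An orientation of a smooth surface `S`, given by an atlas of smooth charts with orientation
preserving transition maps. -/
structure OrientedAtlas (S : Type*) [TopologicalSpace S] [ChartedSpace Coord S]
    [IsManifold (𝓡 2) ∞ S] where
  /-- The positively oriented charts. -/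
  charts : Set (OpenPartialHomeomorph S Coord)
  smooth : charts ⊆ IsManifold.maximalAtlas (𝓡 2) ∞ S
  cover : ∀ q : S, ∃ φ ∈ charts, q ∈ φ.source
  positive : ∀ φ ∈ charts, ∀ ψ ∈ charts, ∀ q ∈ φ.source ∩ ψ.source,
    0 < (fderiv ℝ (ψ ∘ φ.symm) (φ q)).det

section Surface

variable {S : Type*} [TopologicalSpace S] [ChartedSpace Coord S] [IsManifold (𝓡 2) ∞ S]

/-- `F : S → 𝕊²_p × 𝕊²_p` is a `G`-minimal immersion of the oriented surface `S` whose induced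
metric is Riemannian (`ε = 1`) or Lorentzian (`ε = -1`). -/
structure IsMinimalImmersion (A : OrientedAtlas S) (p : ℕ) (ε : ℝ) (F : S → Amb) : Prop where
  smooth : ContMDiff (𝓡 2) 𝓘(ℝ, Amb) ∞ F
  mem : ∀ q, F q ∈ quadric p ×ˢ quadric p
  immersion : ∀ φ ∈ A.charts, ∀ x ∈ φ.target,
    Function.Injective (fderiv ℝ (F ∘ φ.symm) x)
  signature : ∀ φ ∈ A.charts, ∀ x ∈ φ.target,
    ∃ a b : Coord, IsOrientedFrame p ε (F ∘ φ.symm) x a b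
  minimal : ∀ φ ∈ A.charts, ∀ x ∈ φ.target, meanCurvature p (F ∘ φ.symm) x = 0

/-- `C` is the Kähler function of `F` with respect to `Ω_k`, that is, `F*Ω_k = C ω_Σ`. -/
def IsKahlerFunction (A : OrientedAtlas S) (p : ℕ) (ε : ℝ) (F : S → Amb) (k : Fin 2)
    (C : S → ℝ) : Prop :=
  ∀ φ ∈ A.charts, ∀ x ∈ φ.target, ∀ a b : Coord,
    Om p k ((F ∘ φ.symm) x) (fderiv ℝ (F ∘ φ.symm) x a) (fderiv ℝ (F ∘ φ.symm) x b) =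
      C (φ.symm x) * areaForm p ε (F ∘ φ.symm) x a b

end Surface

end NeutralProduct

end

open NeutralProduct

namespace NeutralProduct

/-! ### Scalar products and complex structures -/

/-! Everything reduces to algebra in an adapted frame (E₁, E₂, N, N') at a point. There J_k E₁ and
J_k E₂ are given by C_k and two real numbers r_k, s_k (the components of γ_k up to scale), and
minimality leaves four components f, g, f', g' of the second fundamental form. Write κ = (-1)^k with
k = 0, 1, P = f + εκg' and Q = g - κf'.

Gradient. Since J_k is parallel on the product of quadrics, differentiating C_k = ε Ω_k(E₁, E₂)
involves only the second fundamental form: the derivatives along E₁ and E₂ are ε s_k P + r_k Q and ε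
s_k Q - ε r_k P (`dC_first`, `dC_second`). Hence |∇C_k|² = (s_k² + ε r_k²)(P² + εQ²), by
multiplicativity of the (para-)complex norm. The first factor is b(εC_k² - (-1)^p), because J_k
multiplies G by (-1)^p (`normal_norm`). The second is read off from the Gauss equation (`gauss`) and
the Ricci equation (`normalCurvature_eq`, K^⊥ = 2(fg' - f'g)). The ambient term in the Gauss
equation is (-1)^p C_1 C_2, because it is, up to that sign, the difference of the squared areas of
the two projections of the tangent plane; in the Ricci equation it cancels.

Laplacian. Minimality makes the rotated gradient of C_k equal, up to signs, to an explicit 1-form β,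
the trace of G(dE, J_k E) with a connection correction (`dualForm`, `sqrt_mul_grad`). So ΔC_k is -ε
dβ evaluated on the frame (`laplacian_eq`). Second derivatives of the frame cancel in dβ, and what
remains is quadratic in the first derivatives; the Codazzi equations are never needed. The pointwise
evaluation (`laplacian_identity`) leaves one unknown, Ω_k(N, N'), multiplied by fg' - f'g.

Orientation. If some J_k E₁ has a nonzero normal part, then Ω_k(N, N') = (-1)^k b C_k for both k
(`Om_normal`). If both normal parts vanish at a point, the frame conditions do not fix the order of
(N, N') there. But if the desired value fails at a point, it fails nearby, so the normal parts
vanish on an open set; the surface then lies locally in a slice of the product and is totally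
geodesic, so fg' - f'g = 0. Either way the product in `Om_normal_mul` vanishes, and that is all the
Laplacian needs. -/

lemma eta_mul_self (p : ℕ) (i : Fin 3) : eta p i * eta p i = 1 := by
  unfold eta; split_ifs <;> norm_num

lemma ip_comm (p : ℕ) (u v : R3) : ip p u v = ip p v u := by
  simp only [ip, mul_comm (u _)]

lemma ip_add_left (p : ℕ) (u v w : R3) : ip p (u + v) w = ip p u w + ip p v w := by
  simp only [ip, Fin.sum_univ_three, Pi.add_apply]; ring

lemma ip_smul_left (p : ℕ) (c : ℝ) (u w : R3) : ip p (c • u) w = c * ip p u w := by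
  simp only [ip, Fin.sum_univ_three, Pi.smul_apply, smul_eq_mul]; ring

/-- The scalar product as a bundled bilinear map. -/
noncomputable def ipBilin (p : ℕ) : R3 →L[ℝ] R3 →L[ℝ] ℝ :=
  LinearMap.toContinuousLinearMap
    ((LinearMap.toContinuousLinearMap : (R3 →ₗ[ℝ] ℝ) ≃ₗ[ℝ] _).toLinearMap ∘ₗ
      LinearMap.mk₂ ℝ (ip p) (ip_add_left p) (ip_smul_left p)
        (fun u v w => by rw [ip_comm, ip_add_left, ip_comm p v, ip_comm p w])
        (fun c u v => by rw [ip_comm, ip_smul_left, ip_comm p v]; rfl))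

lemma ipBilin_apply (p : ℕ) (u v : R3) : ipBilin p u v = ip p u v := rfl

lemma ip_add_right (p : ℕ) (u v w : R3) : ip p u (v + w) = ip p u v + ip p u w := by
  simp only [← ipBilin_apply, map_add]

lemma ip_smul_right (p : ℕ) (c : ℝ) (u w : R3) : ip p u (c • w) = c * ip p u w := by
  simp only [← ipBilin_apply, map_smul, smul_eq_mul]

/-- The neutral metric as a bundled bilinear map. -/
noncomputable def neutralBilin (p : ℕ) : Amb →L[ℝ] Amb →L[ℝ] ℝ :=
  (ipBilin p).bilinearComp (ContinuousLinearMap.fst ℝ R3 R3) (ContinuousLinearMap.fst ℝ R3 R3)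
    - (ipBilin p).bilinearComp (ContinuousLinearMap.snd ℝ R3 R3) (ContinuousLinearMap.snd ℝ R3 R3)

lemma neutralBilin_apply (p : ℕ) (V W : Amb) : neutralBilin p V W = G p V W := rfl

lemma G_comm (p : ℕ) (V W : Amb) : G p V W = G p W V := by
  simp only [G, ip_comm p V.1, ip_comm p V.2]

lemma G_add_left (p : ℕ) (U V W : Amb) : G p (U + V) W = G p U W + G p V W := by
  simp only [← neutralBilin_apply, map_add, _root_.add_apply]

lemma G_add_right (p : ℕ) (U V W : Amb) : G p U (V + W) = G p U V + G p U W := by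
  simp only [← neutralBilin_apply, map_add]

lemma G_sub_left (p : ℕ) (U V W : Amb) : G p (U - V) W = G p U W - G p V W := by
  simp only [← neutralBilin_apply, map_sub, _root_.sub_apply]

lemma G_smul_left (p : ℕ) (c : ℝ) (V W : Amb) : G p (c • V) W = c * G p V W := by
  simp only [← neutralBilin_apply, map_smul, _root_.smul_apply, smul_eq_mul]

lemma G_smul_right (p : ℕ) (c : ℝ) (V W : Amb) : G p V (c • W) = c * G p V W := by
  simp only [← neutralBilin_apply, map_smul, smul_eq_mul]

/-- The two factors I_p, one in the scalar product and one in j, cancel, so ω_x(u, v) = -det(x, u,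
v) for every p. Antisymmetry and the determinant identities below follow from this. -/
lemma omega_eq (p : ℕ) (x u v : R3) : omega p x u v =
    -((x 1 * u 2 - x 2 * u 1) * v 0 + (x 2 * u 0 - x 0 * u 2) * v 1
      + (x 0 * u 1 - x 1 * u 0) * v 2) := by
  have h0 := eta_mul_self p 0
  have h1 := eta_mul_self p 1
  have h2 := eta_mul_self p 2
  simp only [omega, ip, jmap, Fin.sum_univ_three, cross_apply, Matrix.cons_val_zero,
    Matrix.cons_val_one, Matrix.cons_val]
  linear_combination (-(x 1 * u 2 - x 2 * u 1) * v 0) * h0 - (x 2 * u 0 - x 0 * u 2) * v 1 * h1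
      - (x 0 * u 1 - x 1 * u 0) * v 2 * h2

/-- `J_k` as a bundled bilinear map in the base point and the vector. -/
noncomputable def JBilin (p : ℕ) (k : Fin 2) : Amb →L[ℝ] Amb →L[ℝ] Amb :=
  LinearMap.toContinuousLinearMap
    ((LinearMap.toContinuousLinearMap : (Amb →ₗ[ℝ] Amb) ≃ₗ[ℝ] _).toLinearMap ∘ₗ
      LinearMap.mk₂ ℝ (J p k)
        (fun x y V => by
          ext i <;> simp [J, jmap] <;> ring)
        (fun c x V => by
          ext i <;> simp [J, jmap] <;> ring)
        (fun x V W => by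
          ext i <;> simp [J, jmap] <;> ring)
        (fun c x V => by
          ext i <;> simp [J, jmap] <;> ring))

lemma JBilin_apply (p : ℕ) (k : Fin 2) (x V : Amb) : JBilin p k x V = J p k x V := rfl

lemma J_add (p : ℕ) (k : Fin 2) (x V W : Amb) : J p k x (V + W) = J p k x V + J p k x W := by
  simp only [← JBilin_apply, map_add]

lemma J_smul (p : ℕ) (k : Fin 2) (c : ℝ) (x V : Amb) : J p k x (c • V) = c • J p k x V := by
  simp only [← JBilin_apply, map_smul]

lemma Om_eq (p : ℕ) (k : Fin 2) (x V W : Amb) : Om p k x V W = G p (J p k x V) W := by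
  simp only [Om, omega, G, J, ip_smul_left]

lemma Om_add_left (p : ℕ) (k : Fin 2) (x U V W : Amb) :
    Om p k x (U + V) W = Om p k x U W + Om p k x V W := by
  simp only [Om_eq, J_add, G_add_left]

lemma Om_smul_left (p : ℕ) (k : Fin 2) (c : ℝ) (x V W : Amb) :
    Om p k x (c • V) W = c * Om p k x V W := by
  simp only [Om_eq, J_smul, G_smul_left]

lemma Om_add_right (p : ℕ) (k : Fin 2) (x U V W : Amb) :
    Om p k x U (V + W) = Om p k x U V + Om p k x U W := by
  simp only [Om_eq, G_add_right]

lemma Om_smul_right (p : ℕ) (k : Fin 2) (c : ℝ) (x V W : Amb) :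
    Om p k x V (c • W) = c * Om p k x V W := by
  simp only [Om_eq, G_smul_right]

lemma Om_swap (p : ℕ) (k : Fin 2) (x V W : Amb) : Om p k x V W = -Om p k x W V := by
  simp only [Om, omega_eq]; ring

lemma Om_self (p : ℕ) (k : Fin 2) (x V : Amb) : Om p k x V V = 0 := by
  linarith [Om_swap p k x V V]

/-- The 2-form is a square root of the Gram determinant. -/
lemma omega_mul_omega {p : ℕ} (hp : p ≤ 2) {x a b c d : R3} (hx : ip p x x = 1)
    (ha : ip p a x = 0) (hb : ip p b x = 0) :
    omega p x a b * omega p x c d =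
      (-1) ^ p * (ip p a c * ip p b d - ip p a d * ip p b c) := by
  -- The product of det(x, a, b) and det(x, c, d) is det I_p = (-1)^p times the Gram determinant of
  -- the two triples; tangency of a and b removes all but one minor.
  have key : omega p x a b * omega p x c d =
      (-1) ^ p * (ip p x x * (ip p a c * ip p b d - ip p a d * ip p b c)
        - ip p x c * (ip p a x * ip p b d - ip p a d * ip p b x)
        + ip p x d * (ip p a x * ip p b c - ip p a c * ip p b x)) := by
    simp only [omega_eq, ip, Fin.sum_univ_three]
    interval_cases p <;> simp [eta] <;> ring
  rw [key, hx, ha, hb]; ring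

/-- Three tangent vectors of the quadric are linearly dependent. -/
lemma omega_tangent {p : ℕ} {x a b c : R3} (hx : ip p x x = 1)
    (ha : ip p a x = 0) (hb : ip p b x = 0) (hc : ip p c x = 0) : omega p a b c = 0 := by
  have key : ip p x x * omega p a b c = ip p a x * omega p x b c - ip p b x * omega p x a c
      + ip p c x * omega p x a b := by
    simp only [omega_eq, ip, Fin.sum_univ_three]; ring
  rw [hx, ha, hb, hc] at key
  linarith

/-- Every 2-form on a three-dimensional space is decomposable, so it satisfies the Plücker relation.
-/
lemma omega_plucker (p : ℕ) (x a b c d : R3) :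
    omega p x a b * omega p x c d - omega p x a c * omega p x b d
      + omega p x a d * omega p x b c = 0 := by
  simp only [omega_eq]; ring

lemma ip_jmap_jmap {p : ℕ} (hp : p ≤ 2) {x a : R3} (hx : ip p x x = 1) (ha : ip p a x = 0)
    (b : R3) : ip p (jmap p x a) (jmap p x b) = (-1) ^ p * ip p a b := by
  have key : ip p (jmap p x a) (jmap p x b) =
      (-1) ^ p * (ip p x x * ip p a b - ip p a x * ip p b x) := by
    simp only [jmap, ip, Fin.sum_univ_three, cross_apply, Matrix.cons_val_zero,
      Matrix.cons_val_one, Matrix.cons_val]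
    interval_cases p <;> simp [eta] <;> ring
  rw [key, hx, ha]; ring

lemma eq_zero_of_ip {p : ℕ} {a : R3} (h : ∀ b, ip p a b = 0) : a = 0 := by
  ext i
  have := h (Pi.single i 1)
  have hne : eta p i ≠ 0 := by
    intro h0; have := eta_mul_self p i; rw [h0] at this; norm_num at this
  simpa [ip, Pi.single_apply, hne] using this

/-- On tangent vectors j scales the scalar product by (-1)^p, and the scalar product is
nondegenerate. -/
lemma jmap_injective {p : ℕ} (hp : p ≤ 2) {x a : R3} (hx : ip p x x = 1) (ha : ip p a x = 0)
    (h : jmap p x a = 0) : a = 0 := by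
  refine eq_zero_of_ip (p := p) fun b => ?_
  have := ip_jmap_jmap hp hx ha b
  rw [h] at this
  have h0 : ip p 0 (jmap p x b) = 0 := by simp [← ipBilin_apply]
  rw [h0] at this
  have hne : ((-1 : ℝ)) ^ p ≠ 0 := by positivity
  exact (mul_eq_zero.1 this.symm).resolve_left hne

lemma neg_one_pow_mul_self (k : ℕ) : ((-1 : ℝ)) ^ k * (-1) ^ k = 1 := by
  rw [← mul_pow]; norm_num

/-- `J_k` is an isometry or an anti-isometry. -/
lemma G_J_J {p : ℕ} (hp : p ≤ 2) (k : Fin 2) {x V : Amb} (hx1 : ip p x.1 x.1 = 1)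
    (hx2 : ip p x.2 x.2 = 1) (h1 : ip p V.1 x.1 = 0) (h2 : ip p V.2 x.2 = 0) (W : Amb) :
    G p (J p k x V) (J p k x W) = (-1) ^ p * G p V W := by
  simp only [G, J, ip_smul_left, ip_smul_right, ip_jmap_jmap hp hx1 h1, ip_jmap_jmap hp hx2 h2]
  linear_combination (-(-1) ^ p * ip p V.2 W.2) * neg_one_pow_mul_self (k : ℕ)

/-- Expansion in a `G`-orthogonal basis of `ℝ³ × ℝ³`. -/
lemma orthogonal_expansion {p : ℕ} {v : Fin 6 → Amb} (hv : ∀ i j, i ≠ j → G p (v i) (v j) = 0)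
    (hn : ∀ i, G p (v i) (v i) ≠ 0) (V : Amb) :
    V = ∑ i, (G p V (v i) / G p (v i) (v i)) • v i := by
  have hli : LinearIndependent ℝ v := by
    rw [Fintype.linearIndependent_iff]
    intro c hc i
    have h := congrArg (fun U => neutralBilin p U (v i)) hc
    simp only [map_sum, map_smul, _root_.sum_apply, _root_.smul_apply,
      map_zero, _root_.zero_apply, neutralBilin_apply, smul_eq_mul] at h
    rw [Finset.sum_eq_single i (fun j _ hj => by rw [hv j i hj, mul_zero]) (by simp)] at h
    exact (mul_eq_zero.1 h).resolve_right (hn i)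
  let B := basisOfLinearIndependentOfCardEqFinrank hli (by simp)
  have hB : ∀ i, B i = v i := fun i => by simp [B]
  have hV := B.sum_repr V
  have hc : ∀ i, G p V (v i) / G p (v i) (v i) = B.repr V i := fun i => by
    have h := congrArg (fun U => neutralBilin p U (v i)) hV
    simp only [map_sum, map_smul, _root_.sum_apply, _root_.smul_apply,
      neutralBilin_apply, smul_eq_mul, hB] at h
    rw [Finset.sum_eq_single i (fun j _ hj => by rw [hv j i hj, mul_zero]) (by simp)] at h
    rw [← h, mul_div_cancel_right₀ _ (hn i)]
  conv_lhs => rw [← hV]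
  simp only [hB, hc]

/-! ### Pointwise algebra of adapted frames -/

/-- A vector-valued form of an adapted frame at a single point `x` of the product of quadrics. -/
structure AdaptedPoint (p : ℕ) (ε b : ℝ) (x E₁ E₂ N N' : Amb) (C r s : Fin 2 → ℝ) : Prop where
  hp : p ≤ 2
  hε : ε * ε = 1
  hb : b * b = 1
  x_fst : ip p x.1 x.1 = 1
  x_snd : ip p x.2 x.2 = 1
  E₁_fst : ip p E₁.1 x.1 = 0
  E₁_snd : ip p E₁.2 x.2 = 0
  E₂_fst : ip p E₂.1 x.1 = 0
  E₂_snd : ip p E₂.2 x.2 = 0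
  N_fst : ip p N.1 x.1 = 0
  N_snd : ip p N.2 x.2 = 0
  N'_fst : ip p N'.1 x.1 = 0
  N'_snd : ip p N'.2 x.2 = 0
  E₁_E₁ : G p E₁ E₁ = 1
  E₁_E₂ : G p E₁ E₂ = 0
  E₂_E₂ : G p E₂ E₂ = ε
  E₁_N : G p E₁ N = 0
  E₁_N' : G p E₁ N' = 0
  E₂_N : G p E₂ N = 0
  E₂_N' : G p E₂ N' = 0
  N_N : G p N N = -(ε * b)
  N_N' : G p N N' = 0
  N'_N' : G p N' N' = -b
  J_E₁ : ∀ k, J p k x E₁ = C k • E₂ + (ε * r k) • N + (ε * (-1) ^ (k : ℕ) * s k) • N'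
  J_E₂ : ∀ k, J p k x E₂ = (-(ε * C k)) • E₁ + (-s k) • N + (ε * (-1) ^ (k : ℕ) * r k) • N'

lemma G_inl (p : ℕ) (V : Amb) (x : R3) : G p V (x, 0) = ip p V.1 x := by
  simp [G, ← ipBilin_apply]

lemma G_inr (p : ℕ) (V : Amb) (x : R3) : G p V (0, x) = -ip p V.2 x := by
  simp [G, ← ipBilin_apply]

lemma Om_inl (p : ℕ) (k : Fin 2) (x V : Amb) : Om p k x V (x.1, 0) = 0 := by
  simp only [Om, omega_eq, Pi.zero_apply]; ring

lemma Om_inr (p : ℕ) (k : Fin 2) (x V : Amb) : Om p k x V (0, x.2) = 0 := by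
  simp only [Om, omega_eq, Pi.zero_apply]; ring

namespace AdaptedPoint

variable {p : ℕ} {ε b : ℝ} {x E₁ E₂ N N' : Amb} {C r s : Fin 2 → ℝ}

/-- The frame together with the two position vectors is a G-orthogonal basis of the ambient space,
with squares 1, ε, -εb, -b, 1, -1. Each of these is its own inverse, so no division appears. -/
lemma expansion (h : AdaptedPoint p ε b x E₁ E₂ N N' C r s) (V : Amb) :
    V = G p V E₁ • E₁ + (ε * G p V E₂) • E₂ + (-(ε * b * G p V N)) • N
      + (-(b * G p V N')) • N' + ip p V.1 x.1 • ((x.1, 0) : Amb)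
      + ip p V.2 x.2 • ((0, x.2) : Amb) := by
  have hε := h.hε
  have hb := h.hb
  have hε0 : ε ≠ 0 := by rintro rfl; simp at hε
  have hb0 : b ≠ 0 := by rintro rfl; simp at hb
  have h11 : G p (x.1, 0) (x.1, 0) = 1 := by rw [G_inl]; exact h.x_fst
  have h22 : G p (0, x.2) (0, x.2) = -1 := by rw [G_inr]; simp [h.x_snd]
  have h12 : G p (x.1, 0) (0, x.2) = 0 := by rw [G_inr]; simp [← ipBilin_apply]
  have o := orthogonal_expansion (p := p)
    (v := ![E₁, E₂, N, N', (x.1, 0), (0, x.2)]) (by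
      have a1 := h.E₁_E₂
      have a2 := h.E₁_N
      have a3 := h.E₁_N'
      have a4 : G p E₁ (x.1, 0) = 0 := by rw [G_inl, h.E₁_fst]
      have a5 : G p E₁ (0, x.2) = 0 := by rw [G_inr, h.E₁_snd, neg_zero]
      have a6 := h.E₂_N
      have a7 := h.E₂_N'
      have a8 : G p E₂ (x.1, 0) = 0 := by rw [G_inl, h.E₂_fst]
      have a9 : G p E₂ (0, x.2) = 0 := by rw [G_inr, h.E₂_snd, neg_zero]
      have b1 := h.N_N'
      have b2 : G p N (x.1, 0) = 0 := by rw [G_inl, h.N_fst]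
      have b3 : G p N (0, x.2) = 0 := by rw [G_inr, h.N_snd, neg_zero]
      have b4 : G p N' (x.1, 0) = 0 := by rw [G_inl, h.N'_fst]
      have b5 : G p N' (0, x.2) = 0 := by rw [G_inr, h.N'_snd, neg_zero]
      have key : ∀ i j : Fin 6, i < j → G p (![E₁, E₂, N, N', (x.1, 0), (0, x.2)] i)
          (![E₁, E₂, N, N', (x.1, 0), (0, x.2)] j) = 0 := by
        intro i j hij
        fin_cases i <;> fin_cases j <;> first | exact absurd hij (by decide) | assumption
      intro i j hij
      rcases lt_or_gt_of_ne hij with h | h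
      · exact key i j h
      · rw [G_comm]; exact key j i h) (by
      intro i
      fin_cases i
      · simp [h.E₁_E₁]
      · simpa [h.E₂_E₂] using hε0
      · simpa [h.N_N] using ⟨hε0, hb0⟩
      · simpa [h.N'_N'] using hb0
      · simp [h11]
      · simp [h22]) V
  rw [Fin.sum_univ_six] at o
  simp only [Matrix.cons_val_zero, Matrix.cons_val_one, Matrix.cons_val, h.E₁_E₁, h.E₂_E₂, h.N_N,
    h.N'_N', h11, h22, G_inl, G_inr] at o
  have e1 : G p V E₂ / ε = ε * G p V E₂ := by
    rw [div_eq_iff hε0]; linear_combination -G p V E₂ * hε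
  have e2 : G p V N / -(ε * b) = -(ε * b * G p V N) := by
    rw [div_eq_iff (by simp [hε0, hb0])]
    linear_combination -G p V N * b * b * hε - G p V N * hb
  have e3 : G p V N' / -b = -(b * G p V N') := by
    rw [div_eq_iff (by simp [hb0])]; linear_combination -G p V N' * hb
  rw [e1, e2, e3, div_one, div_one, neg_div_neg_eq, div_one] at o
  exact o

/-- Separates tangential, normal and radial parts of frame derivatives in the Gauss equation and in
the Laplacian. -/
lemma G_expansion (h : AdaptedPoint p ε b x E₁ E₂ N N' C r s) (U V : Amb) :
    G p U V = G p U E₁ * G p V E₁ + ε * (G p U E₂ * G p V E₂) - ε * b * (G p U N * G p V N)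
      - b * (G p U N' * G p V N') + ip p U.1 x.1 * ip p V.1 x.1
      - ip p U.2 x.2 * ip p V.2 x.2 := by
  conv_lhs => rw [h.expansion V]
  simp only [G_add_right, G_smul_right, G_inl, G_inr]
  ring

lemma Om_E₁ (h : AdaptedPoint p ε b x E₁ E₂ N N' C r s) (k : Fin 2) (V : Amb) :
    Om p k x E₁ V = C k * G p V E₂ + ε * r k * G p V N + ε * (-1) ^ (k : ℕ) * s k * G p V N' := by
  simp only [Om_eq, h.J_E₁, G_add_left, G_smul_left, G_comm p V]

lemma Om_E₂ (h : AdaptedPoint p ε b x E₁ E₂ N N' C r s) (k : Fin 2) (V : Amb) :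
    Om p k x E₂ V = -(ε * C k) * G p V E₁ - s k * G p V N
      + ε * (-1) ^ (k : ℕ) * r k * G p V N' := by
  simp only [Om_eq, h.J_E₂, G_add_left, G_smul_left, G_comm p V]
  ring

/-- The position vectors lie in the kernel of Ω_k, and the images of E₁, E₂ under J_k are known. By
antisymmetry the only value not expressed by C_k, r_k, s_k is Ω_k(N, N'). -/
lemma Om_expansion (h : AdaptedPoint p ε b x E₁ E₂ N N' C r s) (k : Fin 2) (U V : Amb) :
    Om p k x U V = C k * (G p U E₁ * G p V E₂ - G p U E₂ * G p V E₁)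
      + ε * r k * (G p U E₁ * G p V N - G p U N * G p V E₁)
      + ε * (-1) ^ (k : ℕ) * s k * (G p U E₁ * G p V N' - G p U N' * G p V E₁)
      - ε * s k * (G p U E₂ * G p V N - G p U N * G p V E₂)
      + (-1) ^ (k : ℕ) * r k * (G p U E₂ * G p V N' - G p U N' * G p V E₂)
      + ε * Om p k x N N' * (G p U N * G p V N' - G p U N' * G p V N) := by
  have hε := h.hε
  have hb := h.hb
  have hN : ∀ W, Om p k x N W = b * r k * G p W E₁ - b * s k * G p W E₂
      - b * Om p k x N N' * G p W N' := by
    intro W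
    conv_lhs => rw [h.expansion W]
    simp only [Om_add_right, Om_smul_right, Om_inl, Om_inr, Om_swap p k x N E₁,
      Om_swap p k x N E₂, h.Om_E₁, h.Om_E₂, Om_self, h.N_N, h.N_N', G_comm p N E₁, G_comm p N E₂,
      h.E₁_N, h.E₂_N]
    linear_combination (b * r k * G p W E₁ - b * s k * G p W E₂) * hε
  have hN' : ∀ W, Om p k x N' W = ε * b * (-1) ^ (k : ℕ) * s k * G p W E₁
      + b * (-1) ^ (k : ℕ) * r k * G p W E₂ + ε * b * Om p k x N N' * G p W N := by
    intro W
    conv_lhs => rw [h.expansion W]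
    simp only [Om_add_right, Om_smul_right, Om_inl, Om_inr, Om_swap p k x N' E₁,
      Om_swap p k x N' E₂, h.Om_E₁, h.Om_E₂, Om_self, h.N'_N', h.N_N', G_comm p N' E₁,
      G_comm p N' E₂, G_comm p N' N, h.E₁_N', h.E₂_N', Om_swap p k x N' N]
    linear_combination (b * (-1) ^ (k : ℕ) * r k * G p W E₂) * hε
  have hx1 : Om p k x (x.1, 0) V = 0 := by rw [Om_swap, Om_inl, neg_zero]
  have hx2 : Om p k x (0, x.2) V = 0 := by rw [Om_swap, Om_inr, neg_zero]
  conv_lhs => rw [h.expansion U]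
  simp only [Om_add_left, Om_smul_left, hx1, hx2, h.Om_E₁, h.Om_E₂, hN V, hN' V]
  linear_combination (G p U E₂ * G p V E₁ * -C k + (-1) ^ (k : ℕ) * r k * G p U E₂ * G p V N') * hε
    + (- ε * r k * G p U N * G p V E₁ + ε * s k * G p U N * G p V E₂
      + ε * Om p k x N N' * G p U N * G p V N'
      - ε * (-1) ^ (k : ℕ) * s k * G p U N' * G p V E₁ - (-1) ^ (k : ℕ) * r k * G p U N' * G p V E₂
      - ε * Om p k x N N' * G p U N' * G p V N) * hb

/-- The length of the normal part of `J_k E₁`. -/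
lemma normal_norm (h : AdaptedPoint p ε b x E₁ E₂ N N' C r s) (k : Fin 2) :
    ε * C k ^ 2 - (-1) ^ p = b * (ε * r k ^ 2 + s k ^ 2) := by
  have h1 := G_J_J h.hp k h.x_fst h.x_snd h.E₁_fst h.E₁_snd E₁
  rw [h.E₁_E₁, h.J_E₁] at h1
  simp only [G_add_left, G_add_right, G_smul_left, G_smul_right, h.E₂_E₂, h.N_N, h.N'_N', h.N_N',
    h.E₂_N, h.E₂_N', G_comm p N' E₂, G_comm p N' N, G_comm p N E₂] at h1
  have hs := neg_one_pow_mul_self (k : ℕ)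
  linear_combination h1 + (ε * b * r k ^ 2 + b * s k ^ 2 * (-1) ^ (k : ℕ) * (-1) ^ (k : ℕ)) * h.hε
    + b * s k ^ 2 * hs

lemma kahler_eq (h : AdaptedPoint p ε b x E₁ E₂ N N' C r s) (k : Fin 2) :
    omega p x.1 E₁.1 E₂.1 - (-1) ^ (k : ℕ) * omega p x.2 E₁.2 E₂.2 = ε * C k := by
  have := h.Om_E₁ k E₂
  rw [Om, h.E₂_E₂, h.E₂_N, h.E₂_N'] at this
  linarith

/-- The ambient sectional curvature term. -/
lemma ambient_curvature (h : AdaptedPoint p ε b x E₁ E₂ N N' C r s) :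
    ip p E₁.1 E₁.1 * ip p E₂.1 E₂.1 - ip p E₁.1 E₂.1 ^ 2
      - (ip p E₁.2 E₁.2 * ip p E₂.2 E₂.2 - ip p E₁.2 E₂.2 ^ 2) = (-1) ^ p * (C 0 * C 1) := by
  have h1 := omega_mul_omega h.hp (c := E₁.1) (d := E₂.1) h.x_fst h.E₁_fst h.E₂_fst
  have h2 := omega_mul_omega h.hp (c := E₁.2) (d := E₂.2) h.x_snd h.E₁_snd h.E₂_snd
  have k0 := h.kahler_eq 0
  have k1 := h.kahler_eq 1
  simp only [Fin.val_zero, Fin.val_one, pow_zero, pow_one] at k0 k1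
  rw [ip_comm p E₂.1 E₁.1] at h1
  rw [ip_comm p E₂.2 E₁.2] at h2
  have hs := neg_one_pow_mul_self p
  set w₁ := omega p x.1 E₁.1 E₂.1
  set w₂ := omega p x.2 E₁.2 E₂.2
  -- C 0 and C 1 are, up to ε, the difference and the sum of the areas w₁, w₂ of the projected
  -- frame.
  have hC : C 0 * C 1 = w₁ * w₁ - w₂ * w₂ := by
    linear_combination -(C 0 * C 1) * h.hε - ε * C 1 * k0 - (w₁ - w₂) * k1
  rw [hC]
  linear_combination -(-1) ^ p * h1 + (-1) ^ p * h2 - (ip p E₁.1 E₁.1 * ip p E₂.1 E₂.1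
    - ip p E₁.1 E₂.1 ^ 2 - (ip p E₁.2 E₁.2 * ip p E₂.2 E₂.2 - ip p E₁.2 E₂.2 ^ 2)) * hs

/-- The trace over the surface of the definite sum of the two factor metrics. -/
lemma sum_trace (h : AdaptedPoint p ε b x E₁ E₂ N N' C r s) :
    ip p E₁.1 E₁.1 + ip p E₁.2 E₁.2 + ε * (ip p E₂.1 E₂.1 + ip p E₂.2 E₂.2) =
      2 * (ε * (-1) ^ p * (C 0 * C 1)) := by
  have hJ : ∀ V : Amb, ip p V.1 x.1 = 0 → ip p V.2 x.2 = 0 →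
      G p (J p 0 x V) (J p 1 x V) = (-1) ^ p * (ip p V.1 V.1 + ip p V.2 V.2) := by
    intro V h1 h2
    simp only [G, J, ip_smul_left, ip_smul_right, ip_jmap_jmap h.hp h.x_fst h1,
      ip_jmap_jmap h.hp h.x_snd h2, Fin.val_zero, Fin.val_one]
    ring
  have h1 := hJ E₁ h.E₁_fst h.E₁_snd
  have h2 := hJ E₂ h.E₂_fst h.E₂_snd
  simp only [h.J_E₁, h.J_E₂, G_add_left, G_add_right, G_smul_left, G_smul_right, h.E₁_E₁,
    h.E₂_E₂, h.N_N, h.N'_N', h.N_N', h.E₁_N, h.E₁_N', h.E₂_N, h.E₂_N',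
    G_comm p N' E₁, G_comm p N' E₂, G_comm p N' N, G_comm p N E₂, G_comm p N E₁, Fin.val_zero, Fin.val_one] at h1 h2
  have hs := neg_one_pow_mul_self p
  linear_combination -(-1) ^ p * h1 - ε * (-1) ^ p * h2 - (ip p E₁.1 E₁.1 + ip p E₁.2 E₁.2
    + ε * (ip p E₂.1 E₂.1 + ip p E₂.2 E₂.2)) * hs
    + (-1) ^ p * ε * (C 0 * C 1) * h.hε

/-- The orientation of the normal frame is detected by a nonzero normal part of `J_k E₁`. -/
lemma Om_normal (h : AdaptedPoint p ε b x E₁ E₂ N N' C r s)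
    (hne : ∃ k, r k ≠ 0 ∨ s k ≠ 0) (k : Fin 2) :
    Om p k x N N' = (-1) ^ (k : ℕ) * b * C k := by
  have hε0 : ε ≠ 0 := by rintro rfl; simpa using h.hε
  have single : ∀ k, (r k ≠ 0 ∨ s k ≠ 0) → Om p k x N N' = (-1) ^ (k : ℕ) * b * C k := by
    intro k hk
    have hs := neg_one_pow_mul_self (k : ℕ)
    have hJ : ∀ W, G p (J p k x (J p k x E₁)) W = -(-1) ^ p * G p E₁ W := by
      intro W
      rw [← Om_eq, Om_swap, Om_eq, G_comm, G_J_J h.hp k h.x_fst h.x_snd h.E₁_fst h.E₁_snd]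
      ring
    -- This is J_k² E₁ = -(-1)^p E₁ paired with W. Its components along N' and N determine Ω_k(N,
    -- N') as soon as r_k or s_k is nonzero.
    have key : ∀ W, C k * Om p k x E₂ W + ε * r k * Om p k x N W
        + ε * (-1) ^ (k : ℕ) * s k * Om p k x N' W = -(-1) ^ p * G p E₁ W := by
      intro W
      rw [← hJ, h.J_E₁]
      simp only [Om_eq, J_add, J_smul, G_add_left, G_smul_left]
    have k1 := key N'
    have k2 := key N
    rw [h.Om_E₂, Om_self, h.E₁_N', h.N'_N', G_comm p N' N, h.N_N', G_comm, h.E₁_N'] at k1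
    rw [h.Om_E₂, Om_self, h.E₁_N, h.N_N, h.N_N', G_comm p N E₁, h.E₁_N, Om_swap p k x N' N] at k2
    rcases hk with hr | hs'
    · have : ε * r k * (Om p k x N N' - (-1) ^ (k : ℕ) * b * C k) = 0 := by
        linear_combination k1
      rcases mul_eq_zero.1 this with h0 | h0
      · exact absurd h0 (mul_ne_zero hε0 hr)
      · linarith
    · have : ε * s k * (Om p k x N N' - (-1) ^ (k : ℕ) * b * C k) = 0 := by
        linear_combination -(-1) ^ (k : ℕ) * k2 - ε * s k * Om p k x N N' * hs
      rcases mul_eq_zero.1 this with h0 | h0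
      · exact absurd h0 (mul_ne_zero hε0 hs')
      · linarith
  have hmix : C 0 * Om p 1 x N N' + C 1 * Om p 0 x N N' = 0 := by
    have h1 := omega_mul_omega h.hp (c := N.1) (d := N'.1) h.x_fst h.E₁_fst h.E₂_fst
    have h2 := omega_mul_omega h.hp (c := N.2) (d := N'.2) h.x_snd h.E₁_snd h.E₂_snd
    have a1 : ip p E₁.1 N.1 = ip p E₁.2 N.2 := sub_eq_zero.1 h.E₁_N
    have a2 : ip p E₂.1 N.1 = ip p E₂.2 N.2 := sub_eq_zero.1 h.E₂_N
    have a3 : ip p E₁.1 N'.1 = ip p E₁.2 N'.2 := sub_eq_zero.1 h.E₁_N'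
    have a4 : ip p E₂.1 N'.1 = ip p E₂.2 N'.2 := sub_eq_zero.1 h.E₂_N'
    rw [a1, a2, a3, a4, ← h2] at h1
    have k0 := h.kahler_eq 0
    have k1 := h.kahler_eq 1
    simp only [Fin.val_zero, Fin.val_one, pow_zero, pow_one, Om] at k0 k1 ⊢
    refine (mul_eq_zero.1 ?_).resolve_left hε0
    linear_combination 2 * h1 - (omega p x.1 N.1 N'.1 + omega p x.2 N.2 N'.2) * k0
      - (omega p x.1 N.1 N'.1 - omega p x.2 N.2 N'.2) * k1
  have hpl : C 0 * (Om p 0 x N N' - b * C 0) + C 1 * (Om p 1 x N N' + b * C 1) = 0 := by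
    have h1 := omega_plucker p x.1 E₁.1 E₂.1 N.1 N'.1
    have h2 := omega_plucker p x.2 E₁.2 E₂.2 N.2 N'.2
    -- Summing over k cancels the products mixing the two factors and leaves twice the sum of their
    -- Plücker relations.
    have hsum : ∑ k : Fin 2, (Om p k x E₁ E₂ * Om p k x N N' - Om p k x E₁ N * Om p k x E₂ N'
        + Om p k x E₁ N' * Om p k x E₂ N) = 0 := by
      simp only [Om, Fin.sum_univ_two, Fin.val_zero, Fin.val_one]
      linear_combination 2 * h1 + 2 * h2
    simp only [Fin.sum_univ_two, h.Om_E₁, h.Om_E₂, h.E₂_E₂, h.E₂_N, h.E₂_N', h.N_N, h.N_N',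
      h.N'_N', h.E₁_N, h.E₁_N', G_comm p N' N, G_comm p N E₁, G_comm p N' E₁,
      G_comm p N E₂, G_comm p N' E₂, Fin.val_zero, Fin.val_one] at hsum
    have n0 := h.normal_norm 0
    have n1 := h.normal_norm 1
    refine (mul_eq_zero.1 ?_).resolve_left hε0
    linear_combination hsum - b * n0 + b * n1
      + b * b * (ε * r 0 ^ 2 + s 0 ^ 2 - ε * r 1 ^ 2 - s 1 ^ 2) * h.hε
  -- If only one normal part is nonzero, `single` handles that index. For the other, `normal_norm`
  -- forces its Kähler function to be nonzero, and `hpl` then gives the value.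
  have both : Om p 0 x N N' = b * C 0 ∧ Om p 1 x N N' = -(b * C 1) := by
    by_cases h0 : r 0 ≠ 0 ∨ s 0 ≠ 0
    · have e0 := single 0 h0
      simp only [Fin.val_zero, pow_zero, one_mul] at e0
      refine ⟨e0, ?_⟩
      by_cases h1 : r 1 ≠ 0 ∨ s 1 ≠ 0
      · have e1 := single 1 h1
        simp only [Fin.val_one, pow_one] at e1
        linarith
      · push Not at h1
        have n1 := h.normal_norm 1
        rw [h1.1, h1.2] at n1
        have hC1 : C 1 ≠ 0 := by
          intro hC
          rw [hC] at n1
          have : ((-1 : ℝ)) ^ p ≠ 0 := by positivity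
          apply this; linarith
        have : C 1 * (Om p 1 x N N' + b * C 1) = 0 := by rw [e0] at hpl; linarith
        linarith [(mul_eq_zero.1 this).resolve_left hC1]
    · have h1 : r 1 ≠ 0 ∨ s 1 ≠ 0 := by
        obtain ⟨k, hk⟩ := hne
        fin_cases k
        · exact absurd hk h0
        · exact hk
      have e1 := single 1 h1
      simp only [Fin.val_one, pow_one] at e1
      refine ⟨?_, by linarith⟩
      push Not at h0
      have n0 := h.normal_norm 0
      rw [h0.1, h0.2] at n0
      have hC0 : C 0 ≠ 0 := by
        intro hC
        rw [hC] at n0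
        have : ((-1 : ℝ)) ^ p ≠ 0 := by positivity
        apply this; linarith
      have : C 0 * (Om p 0 x N N' - b * C 0) = 0 := by rw [e1] at hpl; linarith
      linarith [(mul_eq_zero.1 this).resolve_left hC0]
  fin_cases k
  · simpa using both.1
  · simpa using both.2

end AdaptedPoint

/-- The components of the derivatives `Uᵢₐ` of the frame vectors `Eₐ` of a minimal surface in the
direction `Eᵢ`: the connection form `t`, and the components `f`, `g` and `f'`, `g'` of the
second fundamental form along `N` and `N'`. -/
structure FrameDerivative (p : ℕ) (ε : ℝ) (x E₁ E₂ N N' U₁₁ U₁₂ U₂₁ U₂₂ : Amb)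
    (t₁ t₂ f g f' g' : ℝ) : Prop where
  t₁₁ : G p U₁₁ E₁ = 0
  t₁₂ : G p U₁₁ E₂ = t₁
  t₂₁ : G p U₁₂ E₁ = -t₁
  t₂₂ : G p U₁₂ E₂ = 0
  t₁₁' : G p U₂₁ E₁ = 0
  t₁₂' : G p U₂₁ E₂ = t₂
  t₂₁' : G p U₂₂ E₁ = -t₂
  t₂₂' : G p U₂₂ E₂ = 0
  f₁₁ : G p U₁₁ N = f
  f₁₂ : G p U₁₂ N = g
  f₂₁ : G p U₂₁ N = g
  f₂₂ : G p U₂₂ N = -(ε * f)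
  f₁₁' : G p U₁₁ N' = f'
  f₁₂' : G p U₁₂ N' = g'
  f₂₁' : G p U₂₁ N' = g'
  f₂₂' : G p U₂₂ N' = -(ε * f')
  x₁₁ : ip p U₁₁.1 x.1 = -ip p E₁.1 E₁.1
  x₁₂ : ip p U₁₂.1 x.1 = -ip p E₁.1 E₂.1
  x₂₁ : ip p U₂₁.1 x.1 = -ip p E₁.1 E₂.1
  x₂₂ : ip p U₂₂.1 x.1 = -ip p E₂.1 E₂.1
  x₁₁' : ip p U₁₁.2 x.2 = -ip p E₁.2 E₁.2
  x₁₂' : ip p U₁₂.2 x.2 = -ip p E₁.2 E₂.2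
  x₂₁' : ip p U₂₁.2 x.2 = -ip p E₁.2 E₂.2
  x₂₂' : ip p U₂₂.2 x.2 = -ip p E₂.2 E₂.2

/-- For a and b tangent at x, det(a, b, c) sees only the radial component of c. This evaluates the
terms in which the base point of J_k is differentiated. -/
lemma omega_base {p : ℕ} {x a b : R3} (hx : ip p x x = 1)
    (ha : ip p a x = 0) (hb : ip p b x = 0) (c : R3) :
    omega p a b c = ip p c x * omega p x a b := by
  have key : ip p x x * omega p a b c = ip p a x * omega p x b c - ip p b x * omega p x a c
      + ip p c x * omega p x a b := by
    simp only [omega_eq, ip, Fin.sum_univ_three]; ring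
  rw [hx, ha, hb] at key
  linarith

/-! ### Pointwise identities for first and second derivatives of the Kähler functions -/

namespace AdaptedPoint

variable {p : ℕ} {ε b : ℝ} {x E₁ E₂ N N' : Amb} {C r s : Fin 2 → ℝ}
  {U₁₁ U₁₂ U₂₁ U₂₂ : Amb} {t₁ t₂ f g f' g' : ℝ}

/-- The differential of the Kähler function in terms of the second fundamental form. -/
lemma dC_first (h : AdaptedPoint p ε b x E₁ E₂ N N' C r s)
    (d : FrameDerivative p ε x E₁ E₂ N N' U₁₁ U₁₂ U₂₁ U₂₂ t₁ t₂ f g f' g') (k : Fin 2) :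
    ε * (Om p k x U₁₁ E₂ + Om p k x E₁ U₁₂) =
      ε * s k * (f + ε * (-1) ^ (k : ℕ) * g') + r k * (g - (-1) ^ (k : ℕ) * f') := by
  rw [Om_swap p k x U₁₁, h.Om_E₁, h.Om_E₂, d.t₁₁, d.f₁₁, d.f₁₁', d.t₂₂, d.f₁₂, d.f₁₂']
  linear_combination r k * (g - (-1) ^ (k : ℕ) * f') * h.hε

/-- The same combinations of f, g, f', g' as in `dC_first` recur, rotated: this is the
Cauchy–Riemann type symmetry imposed by minimality. -/
lemma dC_second (h : AdaptedPoint p ε b x E₁ E₂ N N' C r s)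
    (d : FrameDerivative p ε x E₁ E₂ N N' U₁₁ U₁₂ U₂₁ U₂₂ t₁ t₂ f g f' g') (k : Fin 2) :
    ε * (Om p k x U₂₁ E₂ + Om p k x E₁ U₂₂) =
      ε * s k * (g - (-1) ^ (k : ℕ) * f') - ε * r k * (f + ε * (-1) ^ (k : ℕ) * g') := by
  rw [Om_swap p k x U₂₁, h.Om_E₁, h.Om_E₂, d.t₁₁', d.f₂₁, d.f₂₁', d.t₂₂', d.f₂₂, d.f₂₂']
  linear_combination (-ε * r k * f - s k * ε * (-1) ^ (k : ℕ) * f') * h.hε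

/-- By minimality, the differential of the Kähler function is dual to the trace of
`Ω(h(·, ·), ·)`. -/
lemma dual_first (h : AdaptedPoint p ε b x E₁ E₂ N N' C r s)
    (d : FrameDerivative p ε x E₁ E₂ N N' U₁₁ U₁₂ U₂₁ U₂₂ t₁ t₂ f g f' g') (k : Fin 2) :
    ε * (Om p k x U₁₁ E₂ + Om p k x E₁ U₁₂) =
      -ε * (-(Om p k x E₁ U₂₁ + ε * Om p k x E₂ U₂₂) + 2 * C k * G p U₂₁ E₂) := by
  rw [h.dC_first d, h.Om_E₁, h.Om_E₂, d.t₁₂', d.f₂₁, d.f₂₁', d.t₂₁', d.f₂₂, d.f₂₂']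
  linear_combination (-r k * g - ε * C k * t₂ - ε * s k * f
    + (-1) ^ (k : ℕ) * r k * f' * (1 + ε * ε)) * h.hε

lemma dual_second (h : AdaptedPoint p ε b x E₁ E₂ N N' C r s)
    (d : FrameDerivative p ε x E₁ E₂ N N' U₁₁ U₁₂ U₂₁ U₂₂ t₁ t₂ f g f' g') (k : Fin 2) :
    ε * (Om p k x U₂₁ E₂ + Om p k x E₁ U₂₂) =
      -(Om p k x E₁ U₁₁ + ε * Om p k x E₂ U₁₂) + 2 * C k * G p U₁₁ E₂ := by
  rw [h.dC_second d, h.Om_E₁, h.Om_E₂, d.t₁₂, d.f₁₁, d.f₁₁', d.t₂₁, d.f₁₂, d.f₁₂']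
  linear_combination (C k * t₁) * h.hε

/-- `|∇C|²` in terms of the second fundamental form. -/
lemma gradient_identity (h : AdaptedPoint p ε b x E₁ E₂ N N' C r s)
    (d : FrameDerivative p ε x E₁ E₂ N N' U₁₁ U₁₂ U₂₁ U₂₂ t₁ t₂ f g f' g') (k : Fin 2) :
    (ε * (Om p k x U₁₁ E₂ + Om p k x E₁ U₁₂)) ^ 2
        + ε * (ε * (Om p k x U₂₁ E₂ + Om p k x E₁ U₂₂)) ^ 2 =
      (ε * C k ^ 2 - (-1) ^ p) * (b * (f ^ 2 + ε * f' ^ 2 + ε * g ^ 2 + g' ^ 2)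
        + ε * b * (-1) ^ (k : ℕ) * (2 * (g' * f - f' * g))) := by
  rw [h.dC_first d, h.dC_second d, h.normal_norm]
  have hs := neg_one_pow_mul_self (k : ℕ)
  have hε := h.hε
  have hb := h.hb
  set κ : ℝ := (-1) ^ (k : ℕ)
  -- Since κ² = ε² = 1, the curvature combination is a norm. The identity left after this rewriting
  -- is multiplicativity of the (para-)complex norm.
  have e1 : b * (f ^ 2 + ε * f' ^ 2 + ε * g ^ 2 + g' ^ 2) + ε * b * κ * (2 * (g' * f - f' * g)) =
      b * ((f + ε * κ * g') ^ 2 + ε * (g - κ * f') ^ 2) := by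
    linear_combination -b * (g' ^ 2 + ε * f' ^ 2) * hs - b * g' ^ 2 * κ * κ * hε
  rw [e1]
  set P := f + ε * κ * g'
  set Q := g - κ * f'
  linear_combination (s k ^ 2 * P ^ 2 + ε * s k ^ 2 * Q ^ 2 - 2 * ε * s k * r k * P * Q
      + ε * r k ^ 2 * P ^ 2 - r k ^ 2 * Q ^ 2) * hε
    - (ε * r k ^ 2 + s k ^ 2) * (P ^ 2 + ε * Q ^ 2) * hb

/-- By `omega_base` only the radial components of the frame derivatives enter, and these are minus
the factor scalar products of E₁ and E₂. Normalization of the frame gives the difference of the two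
factor traces and `sum_trace` gives their sum, so each trace is known separately. -/
lemma base_identity (h : AdaptedPoint p ε b x E₁ E₂ N N' C r s)
    (d : FrameDerivative p ε x E₁ E₂ N N' U₁₁ U₁₂ U₂₁ U₂₂ t₁ t₂ f g f' g') (k : Fin 2) :
    -((Om p k E₁ E₁ U₂₁ - Om p k E₂ E₁ U₁₁) + ε * (Om p k E₁ E₂ U₂₂ - Om p k E₂ E₂ U₁₂)) =
      (-1) ^ p * (C 0 * C 1) * C k + ε * C (1 - k) := by
  have hG1 : ip p E₁.1 E₁.1 - ip p E₁.2 E₁.2 = 1 := h.E₁_E₁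
  have hG2 : ip p E₂.1 E₂.1 - ip p E₂.2 E₂.2 = ε := h.E₂_E₂
  have hT := h.sum_trace
  have k0 := h.kahler_eq 0
  have k1 := h.kahler_eq 1
  have hε := h.hε
  simp only [Om, omega_base h.x_fst h.E₁_fst h.E₂_fst, omega_base h.x_snd h.E₁_snd h.E₂_snd,
    omega_base h.x_fst h.E₂_fst h.E₁_fst, omega_base h.x_snd h.E₂_snd h.E₁_snd,
    omega_base h.x_fst h.E₁_fst h.E₁_fst, omega_base h.x_snd h.E₁_snd h.E₁_snd,
    omega_base h.x_fst h.E₂_fst h.E₂_fst, omega_base h.x_snd h.E₂_snd h.E₂_snd,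
    d.x₁₁, d.x₁₂, d.x₂₁, d.x₂₂, d.x₁₁', d.x₁₂', d.x₂₁', d.x₂₂']
  have s1 : ∀ y a, omega p y a a = 0 := fun y a => by rw [omega_eq]; ring
  have s2 : ∀ y, omega p y E₂.1 E₁.1 = -omega p y E₁.1 E₂.1 := fun y => by
    simp only [omega_eq]; ring
  have s3 : ∀ y, omega p y E₂.2 E₁.2 = -omega p y E₁.2 E₂.2 := fun y => by
    simp only [omega_eq]; ring
  simp only [s1, s2, s3]
  set w₁ := omega p x.1 E₁.1 E₂.1
  set w₂ := omega p x.2 E₁.2 E₂.2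
  fin_cases k <;> simp only [Fin.zero_eta, Fin.mk_one, Fin.val_zero, Fin.val_one, pow_zero,
    pow_one, sub_zero, sub_self] at k0 k1 ⊢
  · linear_combination w₁ * (hG1 + ε * hG2 + hT + hε) / 2 - w₂ * (hT - hG1 - ε * hG2 - hε) / 2
      + ε * (-1) ^ p * (C 0 * C 1) * k0 + k1 + (-1) ^ p * (C 0 * C 1) * C 0 * hε
  · linear_combination w₁ * (hG1 + ε * hG2 + hT + hε) / 2 + w₂ * (hT - hG1 - ε * hG2 - hε) / 2
      + ε * (-1) ^ p * (C 0 * C 1) * k1 + k0 + (-1) ^ p * (C 0 * C 1) * C 1 * hε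

/-- The exterior derivative of the form dual to the differential of the Kähler function. -/
lemma laplacian_identity (h : AdaptedPoint p ε b x E₁ E₂ N N' C r s)
    (d : FrameDerivative p ε x E₁ E₂ N N' U₁₁ U₁₂ U₂₁ U₂₂ t₁ t₂ f g f' g') (k : Fin 2) :
    -ε * (-(2 * Om p k x U₁₁ U₂₁ + (Om p k E₁ E₁ U₂₁ - Om p k E₂ E₁ U₁₁)
          + ε * (2 * Om p k x U₁₂ U₂₂ + (Om p k E₁ E₂ U₂₂ - Om p k E₂ E₂ U₁₂)))
        + 2 * (ε * (Om p k x U₁₁ E₂ + Om p k x E₁ U₁₂) * t₂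
          - ε * (Om p k x U₂₁ E₂ + Om p k x E₁ U₂₂) * t₁)
        + 2 * C k * (G p U₂₁ U₁₂ - G p U₁₁ U₂₂)) =
      4 * Om p k x N N' * (f * g' - f' * g)
        + 2 * ε * C k * (b * (f ^ 2 + ε * f' ^ 2 + ε * g ^ 2 + g' ^ 2) + (-1) ^ p * (C 0 * C 1))
        - ε * ((-1) ^ p * (C 0 * C 1) * C k + ε * C (1 - k)) := by
  rw [h.dC_first d, h.dC_second d, ← h.base_identity d]
  have hA := h.ambient_curvature
  have hε := h.hε
  rw [h.Om_expansion k U₁₁ U₂₁, h.Om_expansion k U₁₂ U₂₂, h.G_expansion U₂₁ U₁₂,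
    h.G_expansion U₁₁ U₂₂]
  simp only [d.t₁₁, d.t₁₂, d.t₂₁, d.t₂₂, d.t₁₁', d.t₁₂', d.t₂₁', d.t₂₂', d.f₁₁, d.f₁₂, d.f₂₁,
    d.f₂₂, d.f₁₁', d.f₁₂', d.f₂₁', d.f₂₂', d.x₁₁, d.x₁₂, d.x₂₁, d.x₂₂, d.x₁₁', d.x₁₂', d.x₂₁',
    d.x₂₂']
  -- The connection terms t₁, t₂ must drop out. The contributions of r_k and s_k in Ω_k(U₁₁, U₂₁)
  -- and Ω_k(U₁₂, U₂₂) cancel those produced by dC_k.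
  set κ : ℝ := (-1) ^ (k : ℕ)
  linear_combination (-ε * (-2 * r k * (ε * f * t₁ + g * t₂) - 2 * κ * s k * (ε * t₁ * f' + g' * t₂)
      + 2 * κ * s k * g' * t₂ + 2 * κ * r k * g' * t₁
      - 2 * ε * Om p k x N N' * (f * g' - f' * g)) + 4 * Om p k x N N' * (f * g' - f' * g)
      + 2 * ε * C k * b * f ^ 2) * hε + 2 * ε * C k * hA

/-- If `J_1` and `J_2` agree on the tangent plane, then it is tangent to the first factor. -/
lemma snd_eq_zero (h : AdaptedPoint p ε b x E₁ E₂ N N' C r s)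
    (hr : ∀ k, r k = 0) (hs : ∀ k, s k = 0) (hC : C 1 = C 0) : E₁.2 = 0 ∧ E₂.2 = 0 := by
  have key : ∀ V : Amb, ip p V.2 x.2 = 0 → J p 0 x V = J p 1 x V → V.2 = 0 := by
    intro V hV hJ
    refine jmap_injective h.hp h.x_snd hV ?_
    have h2 : (-1 : ℝ) ^ 0 • jmap p x.2 V.2 = (-1 : ℝ) ^ 1 • jmap p x.2 V.2 :=
      congrArg Prod.snd hJ
    rw [pow_zero, pow_one, one_smul, neg_one_smul] at h2
    exact self_eq_neg.1 h2
  constructor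
  · refine key _ h.E₁_snd ?_
    rw [h.J_E₁, h.J_E₁, hr, hr, hs, hs, hC]; simp
  · refine key _ h.E₂_snd ?_
    rw [h.J_E₂, h.J_E₂, hr, hr, hs, hs, hC]; simp

/-- If `J_1` and `-J_2` agree on the tangent plane, then it is tangent to the second factor. -/
lemma fst_eq_zero (h : AdaptedPoint p ε b x E₁ E₂ N N' C r s)
    (hr : ∀ k, r k = 0) (hs : ∀ k, s k = 0) (hC : C 1 = -C 0) : E₁.1 = 0 ∧ E₂.1 = 0 := by
  have key : ∀ V : Amb, ip p V.1 x.1 = 0 → J p 0 x V = -J p 1 x V → V.1 = 0 := by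
    intro V hV hJ
    refine jmap_injective h.hp h.x_fst hV ?_
    have h2 : jmap p x.1 V.1 = -jmap p x.1 V.1 := congrArg Prod.fst hJ
    exact self_eq_neg.1 h2
  constructor
  · refine key _ h.E₁_fst ?_
    rw [h.J_E₁, h.J_E₁, hr, hr, hs, hs, hC]; simp
  · refine key _ h.E₂_fst ?_
    rw [h.J_E₂, h.J_E₂, hr, hr, hs, hs, hC]; simp

/-- Here E₁ and E₂ span the tangent plane of the first factor. Since V.1 is orthogonal to both,
ω(E₁, E₂) ω(V, d) = 0 for all d by the Gram identity; as ω(E₁, E₂) ≠ 0, this gives j(V.1) = 0. -/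
lemma orthogonal_fst_eq_zero (h : AdaptedPoint p ε b x E₁ E₂ N N' C r s)
    (h1 : E₁.2 = 0) (h2 : E₂.2 = 0) {V : Amb} (hV : ip p V.1 x.1 = 0)
    (hV1 : G p E₁ V = 0) (hV2 : G p E₂ V = 0) : V.1 = 0 := by
  have z : ∀ a, ip p 0 a = 0 := fun a => by simp [← ipBilin_apply]
  have k1 := h.E₁_E₁
  have k2 := h.E₁_E₂
  have k3 := h.E₂_E₂
  simp only [G, h1, h2, z, sub_zero] at k1 k2 k3 hV1 hV2
  have hε0 : ε ≠ 0 := by rintro rfl; simpa using h.hε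
  have hp0 : ((-1 : ℝ)) ^ p ≠ 0 := by positivity
  have hw : omega p x.1 E₁.1 E₂.1 ≠ 0 := by
    intro h0
    have := omega_mul_omega h.hp (c := E₁.1) (d := E₂.1) h.x_fst h.E₁_fst h.E₂_fst
    rw [h0, k1, k2, k3, zero_mul, one_mul, zero_mul, sub_zero] at this
    exact mul_ne_zero hp0 hε0 this.symm
  refine jmap_injective h.hp h.x_fst hV (eq_zero_of_ip (p := p) fun d => ?_)
  have := omega_mul_omega h.hp (c := V.1) (d := d) h.x_fst h.E₁_fst h.E₂_fst
  rw [hV1, hV2, zero_mul, mul_zero, sub_zero, mul_zero] at this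
  exact (mul_eq_zero.1 this).resolve_left hw

lemma orthogonal_snd_eq_zero (h : AdaptedPoint p ε b x E₁ E₂ N N' C r s)
    (h1 : E₁.1 = 0) (h2 : E₂.1 = 0) {V : Amb} (hV : ip p V.2 x.2 = 0)
    (hV1 : G p E₁ V = 0) (hV2 : G p E₂ V = 0) : V.2 = 0 := by
  have z : ∀ a, ip p 0 a = 0 := fun a => by simp [← ipBilin_apply]
  have k1 := h.E₁_E₁
  have k2 := h.E₁_E₂
  have k3 := h.E₂_E₂
  simp only [G, h1, h2, z, zero_sub, neg_eq_zero] at k1 k2 k3 hV1 hV2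
  have hε0 : ε ≠ 0 := by rintro rfl; simpa using h.hε
  have hp0 : ((-1 : ℝ)) ^ p ≠ 0 := by positivity
  have hw : omega p x.2 E₁.2 E₂.2 ≠ 0 := by
    intro h0
    have := omega_mul_omega h.hp (c := E₁.2) (d := E₂.2) h.x_snd h.E₁_snd h.E₂_snd
    rw [h0, k2, neg_eq_iff_eq_neg.1 k1, neg_eq_iff_eq_neg.1 k3] at this
    refine mul_ne_zero hp0 hε0 ?_
    linarith
  refine jmap_injective h.hp h.x_snd hV (eq_zero_of_ip (p := p) fun d => ?_)
  have := omega_mul_omega h.hp (c := V.2) (d := d) h.x_snd h.E₁_snd h.E₂_snd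
  rw [hV1, hV2, zero_mul, mul_zero, sub_zero, mul_zero] at this
  exact (mul_eq_zero.1 this).resolve_left hw

end AdaptedPoint

/-! ### Partial derivatives -/

section Calculus

variable {E F H : Type} [NormedAddCommGroup E] [NormedSpace ℝ E] [NormedAddCommGroup F]
  [NormedSpace ℝ F] [NormedAddCommGroup H] [NormedSpace ℝ H] {x : Coord}

lemma pd_congr {f g : Coord → E} (h : f =ᶠ[nhds x] g) (i : Fin 2) : pd i f x = pd i g x := by
  rw [pd, pd, h.fderiv_eq]

lemma contDiffAt_pd {f : Coord → E} (h : ContDiffAt ℝ ∞ f x) (i : Fin 2) :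
    ContDiffAt ℝ ∞ (pd i f) x :=
  (h.fderiv_right (m := ∞) (by simp)).clm_apply contDiffAt_const

lemma pd_comm {f : Coord → E} (h : ContDiffAt ℝ ∞ f x) (i j : Fin 2) :
    pd i (pd j f) x = pd j (pd i f) x := by
  have hs : IsSymmSndFDerivAt ℝ f x :=
    h.isSymmSndFDerivAt (by simpa using WithTop.coe_le_coe.2 (le_top : (2 : ℕ∞) ≤ ⊤))
  have hd : DifferentiableAt ℝ (fderiv ℝ f) x :=
    (h.fderiv_right (m := ∞) (by simp)).differentiableAt (by simp)
  have key : ∀ i j, pd i (pd j f) x =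
      fderiv ℝ (fderiv ℝ f) x (EuclideanSpace.single i 1) (EuclideanSpace.single j 1) := by
    intro i j
    unfold pd
    rw [fderiv_clm_apply hd (differentiableAt_const _)]
    simp
  rw [key, key, hs]

lemma pd_bilin (B : E →L[ℝ] F →L[ℝ] H) {f : Coord → E} {g : Coord → F}
    (hf : DifferentiableAt ℝ f x) (hg : DifferentiableAt ℝ g x) (i : Fin 2) :
    pd i (fun y => B (f y) (g y)) x = B (pd i f x) (g x) + B (f x) (pd i g x) := by
  unfold pd
  rw [B.fderiv_of_bilinear hf hg]
  simp [add_comm]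

lemma contDiffAt_bilin (B : E →L[ℝ] F →L[ℝ] H) {f : Coord → E} {g : Coord → F}
    (hf : ContDiffAt ℝ ∞ f x) (hg : ContDiffAt ℝ ∞ g x) :
    ContDiffAt ℝ ∞ (fun y => B (f y) (g y)) x :=
  (B.contDiff.contDiffAt.comp x hf).clm_apply hg

lemma pd_mul {f g : Coord → ℝ} (hf : DifferentiableAt ℝ f x) (hg : DifferentiableAt ℝ g x)
    (i : Fin 2) : pd i (fun y => f y * g y) x = pd i f x * g x + f x * pd i g x := by
  simpa using pd_bilin (ContinuousLinearMap.mul ℝ ℝ) hf hg i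

lemma pd_smul {f : Coord → ℝ} {g : Coord → E} (hf : DifferentiableAt ℝ f x)
    (hg : DifferentiableAt ℝ g x) (i : Fin 2) :
    pd i (fun y => f y • g y) x = pd i f x • g x + f x • pd i g x := by
  simpa using pd_bilin (ContinuousLinearMap.lsmul ℝ ℝ) hf hg i

lemma contDiffAt_fun_smul {f : Coord → ℝ} {g : Coord → E} (hf : ContDiffAt ℝ ∞ f x)
    (hg : ContDiffAt ℝ ∞ g x) : ContDiffAt ℝ ∞ (fun y => f y • g y) x :=
  hf.smul hg

lemma pd_add {f g : Coord → E} (hf : DifferentiableAt ℝ f x) (hg : DifferentiableAt ℝ g x)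
    (i : Fin 2) : pd i (fun y => f y + g y) x = pd i f x + pd i g x := by
  unfold pd
  rw [fderiv_fun_add hf hg, add_apply]

lemma pd_sub {f g : Coord → E} (hf : DifferentiableAt ℝ f x) (hg : DifferentiableAt ℝ g x)
    (i : Fin 2) : pd i (fun y => f y - g y) x = pd i f x - pd i g x := by
  unfold pd
  rw [fderiv_fun_sub hf hg, sub_apply]

lemma pd_const (c : E) (i : Fin 2) : pd i (fun _ => c) x = 0 := by
  simp [pd]

lemma pd_const_mul {f : Coord → ℝ} (c : ℝ) (hf : DifferentiableAt ℝ f x) (i : Fin 2) :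
    pd i (fun y => c * f y) x = c * pd i f x := by
  rw [pd_mul (differentiableAt_const c) hf, pd_const]; ring

lemma pd_neg {f : Coord → ℝ} (i : Fin 2) : pd i (fun y => -f y) x = -pd i f x := by
  unfold pd
  rw [fderiv_fun_neg, neg_apply]

lemma pd_fst {f : Coord → E × F} (hf : DifferentiableAt ℝ f x) (i : Fin 2) :
    pd i (fun y => (f y).1) x = (pd i f x).1 := by
  unfold pd
  rw [fderiv.fst hf]; rfl

lemma pd_snd {f : Coord → E × F} (hf : DifferentiableAt ℝ f x) (i : Fin 2) :
    pd i (fun y => (f y).2) x = (pd i f x).2 := by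
  unfold pd
  rw [fderiv.snd hf]; rfl

lemma pd_prodMk {f : Coord → E} {g : Coord → F} (hf : DifferentiableAt ℝ f x)
    (hg : DifferentiableAt ℝ g x) (i : Fin 2) :
    pd i (fun y => (f y, g y)) x = (pd i f x, pd i g x) := by
  unfold pd
  rw [hf.fderiv_prodMk hg]; rfl

lemma fderiv_eq_sum_pd (f : Coord → E) (a : Coord) :
    fderiv ℝ f x a = a 0 • pd 0 f x + a 1 • pd 1 f x := by
  have : a = a 0 • EuclideanSpace.single 0 1 + a 1 • EuclideanSpace.single 1 (1 : ℝ) := by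
    ext i; fin_cases i <;> simp
  conv_lhs => rw [this]
  simp only [map_add, map_smul, pd]

end Calculus

/-! ### Product rules for the ambient forms -/

section AmbientCalculus

variable {x : Coord} {V W : Coord → Amb}

lemma pd_G {p : ℕ} (hV : DifferentiableAt ℝ V x) (hW : DifferentiableAt ℝ W x) (i : Fin 2) :
    pd i (fun y => G p (V y) (W y)) x = G p (pd i V x) (W x) + G p (V x) (pd i W x) :=
  pd_bilin (neutralBilin p) hV hW i

lemma contDiffAt_G {p : ℕ} (hV : ContDiffAt ℝ ∞ V x) (hW : ContDiffAt ℝ ∞ W x) :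
    ContDiffAt ℝ ∞ (fun y => G p (V y) (W y)) x :=
  contDiffAt_bilin (neutralBilin p) hV hW

lemma pd_ip {p : ℕ} {u v : Coord → R3} (hu : DifferentiableAt ℝ u x)
    (hv : DifferentiableAt ℝ v x) (i : Fin 2) :
    pd i (fun y => ip p (u y) (v y)) x = ip p (pd i u x) (v x) + ip p (u x) (pd i v x) :=
  pd_bilin (ipBilin p) hu hv i

lemma contDiffAt_ip {p : ℕ} {u v : Coord → R3} (hu : ContDiffAt ℝ ∞ u x)
    (hv : ContDiffAt ℝ ∞ v x) : ContDiffAt ℝ ∞ (fun y => ip p (u y) (v y)) x :=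
  contDiffAt_bilin (ipBilin p) hu hv

lemma pd_J {p : ℕ} {k : Fin 2} (hV : DifferentiableAt ℝ V x) (hW : DifferentiableAt ℝ W x)
    (i : Fin 2) :
    pd i (fun y => J p k (V y) (W y)) x = J p k (pd i V x) (W x) + J p k (V x) (pd i W x) :=
  pd_bilin (JBilin p k) hV hW i

lemma contDiffAt_J {p : ℕ} {k : Fin 2} (hV : ContDiffAt ℝ ∞ V x) (hW : ContDiffAt ℝ ∞ W x) :
    ContDiffAt ℝ ∞ (fun y => J p k (V y) (W y)) x :=
  contDiffAt_bilin (JBilin p k) hV hW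

end AmbientCalculus

/-! ### Framed minimal patches -/

/-- A minimal coordinate patch over `W` with Kähler functions `C`. -/
structure MinimalPatch (p : ℕ) (ε : ℝ) (X : Coord → Amb) (C : Fin 2 → Coord → ℝ)
    (W : Set Coord) : Prop where
  hp : p ≤ 2
  hε : ε * ε = 1
  isOpen : IsOpen W
  smooth : ∀ y ∈ W, ContDiffAt ℝ ∞ X y
  mem : ∀ y ∈ W, X y ∈ quadric p ×ˢ quadric p
  minimal : ∀ y ∈ W, meanCurvature p X y = 0
  kahler : ∀ y ∈ W, ∀ k a b, Om p k (X y) (fderiv ℝ X y a) (fderiv ℝ X y b) =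
    C k y * areaForm p ε X y a b

/-- The image of a tangent vector field under the differential of the patch. -/
noncomputable def push (X : Coord → Amb) (e : Coord → Coord) (y : Coord) : Amb :=
  fderiv ℝ X y (e y)

section Patch

variable {p : ℕ} {ε b : ℝ} {X : Coord → Amb} {C : Fin 2 → Coord → ℝ} {W : Set Coord}
  {e₁ e₂ : Coord → Coord} {N N' : Coord → Amb} {y : Coord}

/-! ### The induced metric in an orthonormal frame -/

lemma gram_comm (p : ℕ) (X : Coord → Amb) (y : Coord) (i j : Fin 2) :
    gram p X y i j = gram p X y j i := by
  simp only [gram, Matrix.of_apply, G_comm p (pd i X y)]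

lemma gForm_eq (p : ℕ) (X : Coord → Amb) (y a c : Coord) :
    gForm p X y a c = a 0 * c 0 * gram p X y 0 0 + (a 0 * c 1 + a 1 * c 0) * gram p X y 0 1
      + a 1 * c 1 * gram p X y 1 1 := by
  simp only [gForm, fderiv_eq_sum_pd, G_add_left, G_add_right, G_smul_left, G_smul_right, gram,
    Matrix.of_apply, G_comm p (pd 1 X y) (pd 0 X y)]
  ring

lemma gram_inv {ε : ℝ} (hε : ε * ε = 1) {a c : Coord} (h : IsOrientedFrame p ε X y a c)
    (i j : Fin 2) : (gram p X y)⁻¹ i j = a i * a j + ε * (c i * c j) := by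
  obtain ⟨h1, h2, h3, -⟩ := h
  rw [gForm_eq] at h1 h2 h3
  let M : Matrix (Fin 2) (Fin 2) ℝ := !![a 0, c 0; a 1, c 1]
  let M' : Matrix (Fin 2) (Fin 2) ℝ := !![a 0, a 1; c 0, c 1]
  let D : Matrix (Fin 2) (Fin 2) ℝ := !![1, 0; 0, ε]
  have h10 := gram_comm p X y 1 0
  have hg : gram p X y = !![gram p X y 0 0, gram p X y 0 1; gram p X y 0 1, gram p X y 1 1] := by
    ext i j; fin_cases i <;> fin_cases j <;> simp [h10]
  -- With the frame as columns of M, Mᵀ g M = D = diag(1, ε), which is its own inverse; hence g⁻¹ =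
  -- M D Mᵀ.
  have key : M' * (gram p X y * M * D) = 1 := by
    rw [hg]
    ext i j
    fin_cases i <;> fin_cases j <;>
      simp [M, M', D, Matrix.mul_apply, Fin.sum_univ_two]
    · linear_combination h1
    · linear_combination ε * h2
    · linear_combination h2
    · linear_combination ε * h3 + hε
  rw [mul_eq_one_comm, Matrix.mul_assoc, Matrix.mul_assoc] at key
  rw [Matrix.inv_eq_right_inv key]
  fin_cases i <;> fin_cases j <;>
    simp [M, M', D, Matrix.mul_apply, Fin.sum_univ_two] <;> ring

lemma det_gram {ε : ℝ} {a c : Coord} (h : IsOrientedFrame p ε X y a c) :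
    coordDet a c ^ 2 * (gram p X y).det = ε := by
  obtain ⟨h1, h2, h3, -⟩ := h
  rw [gForm_eq] at h1 h2 h3
  rw [Matrix.det_fin_two, gram_comm p X y 1 0, coordDet]
  linear_combination (c 0 * c 0 * gram p X y 0 0 + (c 0 * c 1 + c 1 * c 0) * gram p X y 0 1
      + c 1 * c 1 * gram p X y 1 1) * h1 + h3
      - (a 0 * c 0 * gram p X y 0 0 + (a 0 * c 1 + a 1 * c 0) * gram p X y 0 1
      + a 1 * c 1 * gram p X y 1 1) * h2

lemma sqrt_det_gram {ε : ℝ} (hε : ε * ε = 1) {a c : Coord} (h : IsOrientedFrame p ε X y a c) :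
    Real.sqrt |(gram p X y).det| = (coordDet a c)⁻¹ := by
  have hd := det_gram h
  have hpos := h.2.2.2
  have habs : |ε| = 1 := by
    rcases mul_self_eq_one_iff.1 hε with h | h <;> simp [h]
  have : |(gram p X y).det| = ((coordDet a c)⁻¹) ^ 2 := by
    have h2 := congrArg abs hd
    rw [abs_mul, habs, abs_of_nonneg (sq_nonneg _)] at h2
    field_simp
    linarith
  rw [this, Real.sqrt_sq (by positivity)]

variable (hM : MinimalPatch p ε X C W)
  (hf : IsAdaptedFrame p ε b X C W e₁ e₂ N N')

include hM

lemma MinimalPatch.eventually (hy : y ∈ W) {P : Coord → Prop} (h : ∀ z ∈ W, P z) :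
    ∀ᶠ z in nhds y, P z :=
  Filter.eventually_of_mem (hM.isOpen.mem_nhds hy) h

lemma MinimalPatch.pd_congr_on (hy : y ∈ W) {E : Type} [NormedAddCommGroup E] [NormedSpace ℝ E]
    {f g : Coord → E} (h : ∀ z ∈ W, f z = g z) (i : Fin 2) : pd i f y = pd i g y :=
  pd_congr (hM.eventually hy h) i

lemma MinimalPatch.contDiffAt_congr_on (hy : y ∈ W) {E : Type} [NormedAddCommGroup E]
    [NormedSpace ℝ E] {f g : Coord → E} (h : ∀ z ∈ W, f z = g z) (hg : ContDiffAt ℝ ∞ g y) :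
    ContDiffAt ℝ ∞ f y :=
  hg.congr_of_eventuallyEq (hM.eventually hy h)

lemma MinimalPatch.diff (hy : y ∈ W) : DifferentiableAt ℝ X y :=
  (hM.smooth y hy).differentiableAt (by simp)

lemma MinimalPatch.ip_pd_fst (hy : y ∈ W) {V : Coord → Amb} (hV : DifferentiableAt ℝ V y)
    (h : ∀ z ∈ W, ip p (V z).1 (X z).1 = 0) (i : Fin 2) :
    ip p (pd i V y).1 (X y).1 = -ip p (V y).1 (pd i X y).1 := by
  have h1 := pd_ip (p := p) hV.fst (hM.diff hy).fst i
  rw [hM.pd_congr_on hy h, pd_const, pd_fst hV, pd_fst (hM.diff hy)] at h1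
  linarith

lemma MinimalPatch.ip_pd_snd (hy : y ∈ W) {V : Coord → Amb} (hV : DifferentiableAt ℝ V y)
    (h : ∀ z ∈ W, ip p (V z).2 (X z).2 = 0) (i : Fin 2) :
    ip p (pd i V y).2 (X y).2 = -ip p (V y).2 (pd i X y).2 := by
  have h1 := pd_ip (p := p) hV.snd (hM.diff hy).snd i
  rw [hM.pd_congr_on hy h, pd_const, pd_snd hV, pd_snd (hM.diff hy)] at h1
  linarith

lemma MinimalPatch.G_pd (hy : y ∈ W) {U V : Coord → Amb} (hU : DifferentiableAt ℝ U y)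
    (hV : DifferentiableAt ℝ V y) {c : ℝ}
    (h : ∀ z ∈ W, G p (U z) (V z) = c) (i : Fin 2) :
    G p (pd i U y) (V y) = -G p (U y) (pd i V y) := by
  have h1 := pd_G (p := p) hU hV i
  rw [hM.pd_congr_on hy h, pd_const] at h1
  linarith

lemma MinimalPatch.tangent_fst (hy : y ∈ W) (i : Fin 2) : ip p (pd i X y).1 (X y).1 = 0 := by
  have h1 := pd_ip (p := p) (hM.diff hy).fst (hM.diff hy).fst i
  rw [hM.pd_congr_on hy (fun z hz => (hM.mem z hz).1), pd_const, pd_fst (hM.diff hy),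
    ip_comm p (X y).1] at h1
  linarith

lemma MinimalPatch.tangent_snd (hy : y ∈ W) (i : Fin 2) : ip p (pd i X y).2 (X y).2 = 0 := by
  have h1 := pd_ip (p := p) (hM.diff hy).snd (hM.diff hy).snd i
  rw [hM.pd_congr_on hy (fun z hz => (hM.mem z hz).2), pd_const, pd_snd (hM.diff hy),
    ip_comm p (X y).2] at h1
  linarith

lemma MinimalPatch.smooth_pd (hy : y ∈ W) (i : Fin 2) : ContDiffAt ℝ ∞ (pd i X) y :=
  contDiffAt_pd (hM.smooth y hy) i

omit hM in
lemma push_eq (e : Coord → Coord) (z : Coord) :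
    push X e z = e z 0 • pd 0 X z + e z 1 • pd 1 X z := fderiv_eq_sum_pd X (e z)

lemma MinimalPatch.contDiffAt_push (hy : y ∈ W) {e : Coord → Coord} (he : ContDiffAt ℝ ∞ e y) :
    ContDiffAt ℝ ∞ (push X e) y :=
  ((hM.smooth y hy).fderiv_right (m := ∞) (by simp)).clm_apply he

lemma MinimalPatch.push_fst (hy : y ∈ W) (e : Coord → Coord) :
    ip p (push X e y).1 (X y).1 = 0 := by
  rw [push_eq, Prod.fst_add, Prod.smul_fst, Prod.smul_fst, ip_add_left, ip_smul_left,
    ip_smul_left, hM.tangent_fst hy, hM.tangent_fst hy]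
  ring

lemma MinimalPatch.push_snd (hy : y ∈ W) (e : Coord → Coord) :
    ip p (push X e y).2 (X y).2 = 0 := by
  rw [push_eq, Prod.snd_add, Prod.smul_snd, Prod.smul_snd, ip_add_left, ip_smul_left,
    ip_smul_left, hM.tangent_snd hy, hM.tangent_snd hy]
  ring

include hf

lemma MinimalPatch.smooth_e₁ (hy : y ∈ W) : ContDiffAt ℝ ∞ e₁ y :=
  hf.smooth_e₁.contDiffAt (hM.isOpen.mem_nhds hy)

lemma MinimalPatch.smooth_e₂ (hy : y ∈ W) : ContDiffAt ℝ ∞ e₂ y :=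
  hf.smooth_e₂.contDiffAt (hM.isOpen.mem_nhds hy)

lemma MinimalPatch.smooth_N (hy : y ∈ W) : ContDiffAt ℝ ∞ N y :=
  hf.smooth_N.contDiffAt (hM.isOpen.mem_nhds hy)

lemma MinimalPatch.smooth_N' (hy : y ∈ W) : ContDiffAt ℝ ∞ N' y :=
  hf.smooth_N'.contDiffAt (hM.isOpen.mem_nhds hy)

/-- The Kähler functions are `ε Ω_k(E₁, E₂)`. -/
lemma MinimalPatch.kahler_frame (hy : y ∈ W) (k : Fin 2) :
    C k y = ε * Om p k (X y) (push X e₁ y) (push X e₂ y) := by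
  have ho := hf.oriented y hy
  have hpos := ho.2.2.2
  rw [push, push, hM.kahler y hy k, areaForm, sqrt_det_gram hM.hε ho,
    inv_mul_cancel₀ hpos.ne']
  linear_combination -C k y * hM.hε

lemma MinimalPatch.adaptedPoint (hb : b * b = 1) (hy : y ∈ W) : ∃ r s : Fin 2 → ℝ,
    AdaptedPoint p ε b (X y) (push X e₁ y) (push X e₂ y) (N y) (N' y) (fun k => C k y) r s := by
  obtain ⟨c, hc⟩ := hf.J_one y hy
  obtain ⟨d, hd⟩ := hf.J_two y hy
  have ho := hf.oriented y hy
  have hε := hM.hε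
  have e1 := congrArg Prod.fst hc
  have e2 := congrArg Prod.snd hc
  have e3 := congrArg Prod.fst hd
  have e4 := congrArg Prod.snd hd
  simp only [pcJ, pcSmul, pcConj, pcTangent, pcNormal, Prod.smul_mk, Prod.fst_add, Prod.snd_add,
    J_smul, zero_smul, ← neg_smul] at e1 e2 e3 e4
  -- The 2 clears the 1/2 in Z, and (√2)⁻¹ comes from ξ. Twice the real part of the frame condition
  -- gives J_k E₁, and -2ε times the imaginary part gives J_k E₂; the conjugate of ξ in the second
  -- condition produces the sign (-1)^k.
  refine ⟨![2 * (Real.sqrt 2)⁻¹ * c.1, 2 * (Real.sqrt 2)⁻¹ * d.1],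
    ![2 * (Real.sqrt 2)⁻¹ * c.2, 2 * (Real.sqrt 2)⁻¹ * d.2], ?_⟩
  exact
  { hp := hM.hp
    hε := hε
    hb := hb
    x_fst := (hM.mem y hy).1
    x_snd := (hM.mem y hy).2
    E₁_fst := hM.push_fst hy e₁
    E₁_snd := hM.push_snd hy e₁
    E₂_fst := hM.push_fst hy e₂
    E₂_snd := hM.push_snd hy e₂
    N_fst := (hf.ambient_N y hy).1
    N_snd := (hf.ambient_N y hy).2
    N'_fst := (hf.ambient_N' y hy).1
    N'_snd := (hf.ambient_N' y hy).2
    E₁_E₁ := ho.1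
    E₁_E₂ := ho.2.1
    E₂_E₂ := ho.2.2.1
    E₁_N := hf.normal_N y hy _
    E₁_N' := hf.normal_N' y hy _
    E₂_N := hf.normal_N y hy _
    E₂_N' := hf.normal_N' y hy _
    N_N := hf.norm_N y hy
    N_N' := hf.orthogonal y hy
    N'_N' := by
      have := hf.norm_N' y hy
      linear_combination ε * this - (G p (N' y) (N' y) + b) * hε
    J_E₁ := by
      intro k
      fin_cases k
      · simp only [push, Fin.zero_eta, Matrix.cons_val_zero, pow_zero]
        linear_combination (norm := module) (2 : ℝ) • e1 + (C 0 y * hε) • (fderiv ℝ X y (e₂ y))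
          + ((ε * 2 * (√2)⁻¹ * c.2) * hε) • N' y
      · simp only [push, Fin.mk_one, Matrix.cons_val_one, Matrix.cons_val_zero, pow_one]
        linear_combination (norm := module) (2 : ℝ) • e3 + (C 1 y * hε) • (fderiv ℝ X y (e₂ y))
          - ((ε * 2 * (√2)⁻¹ * d.2) * hε) • N' y
    J_E₂ := by
      intro k
      fin_cases k
      · simp only [push, Fin.zero_eta, Matrix.cons_val_zero, pow_zero]
        linear_combination (norm := module) (-2 * ε : ℝ) • e2 - hε • J p 0 (X y) (fderiv ℝ X y (e₂ y))
          + ((ε * 2 * (√2)⁻¹ * c.1) * hε) • N' y - ((2 * (√2)⁻¹ * c.2) * hε) • N y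
      · simp only [push, Fin.mk_one, Matrix.cons_val_one, Matrix.cons_val_zero, pow_one]
        linear_combination (norm := module) (-2 * ε : ℝ) • e4 - hε • J p 1 (X y) (fderiv ℝ X y (e₂ y))
          - ((ε * 2 * (√2)⁻¹ * d.1) * hε) • N' y - ((2 * (√2)⁻¹ * d.2) * hε) • N y }

end Patch

/-! ### The equations of Gauss and Ricci -/

section Patch

variable {p : ℕ} {ε b : ℝ} {X : Coord → Amb} {C : Fin 2 → Coord → ℝ} {W : Set Coord}
  {e₁ e₂ : Coord → Coord} {N N' : Coord → Amb} {y : Coord}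
  (hM : MinimalPatch p ε X C W) (hf : IsAdaptedFrame p ε b X C W e₁ e₂ N N')

include hM

lemma MinimalPatch.pd_gram (hy : y ∈ W) (i j l : Fin 2) :
    pd i (fun z => gram p X z j l) y =
      G p (pd i (pd j X) y) (pd l X y) + G p (pd i (pd l X) y) (pd j X y) := by
  have h := pd_G (p := p) ((hM.smooth_pd hy j).differentiableAt (by simp))
    ((hM.smooth_pd hy l).differentiableAt (by simp)) i
  rw [G_comm p (pd j X y)] at h
  exact h

/-- Expanding the derivatives of the Gram matrix and commuting partials, four of the six terms
cancel and the other two coincide. -/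
lemma MinimalPatch.christoffel_eq (hy : y ∈ W) (k i j : Fin 2) :
    christoffel p X k i j y =
      ∑ l, (gram p X y)⁻¹ k l * G p (pd i (pd j X) y) (pd l X y) := by
  rw [christoffel, Finset.mul_sum]
  refine Finset.sum_congr rfl fun l _ => ?_
  rw [hM.pd_gram hy, hM.pd_gram hy, hM.pd_gram hy, pd_comm (hM.smooth y hy) j i,
    pd_comm (hM.smooth y hy) l i, pd_comm (hM.smooth y hy) l j]
  ring

lemma MinimalPatch.contDiffAt_gram (hy : y ∈ W) (i j : Fin 2) :
    ContDiffAt ℝ ∞ (fun z => gram p X z i j) y :=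
  contDiffAt_G (hM.smooth_pd hy i) (hM.smooth_pd hy j)

include hf

/-- The inverse metric is polynomial in the components of the smooth orthonormal frame. -/
lemma MinimalPatch.contDiffAt_gram_inv (hy : y ∈ W) (i j : Fin 2) :
    ContDiffAt ℝ ∞ (fun z => (gram p X z)⁻¹ i j) y := by
  have h₁ : ∀ i, ContDiffAt ℝ ∞ (fun z => e₁ z i) y := fun i =>
    (contDiffAt_piLp 2).1 (hM.smooth_e₁ hf hy) i
  have h₂ : ∀ i, ContDiffAt ℝ ∞ (fun z => e₂ z i) y := fun i =>
    (contDiffAt_piLp 2).1 (hM.smooth_e₂ hf hy) i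
  exact hM.contDiffAt_congr_on hy (fun z hz => gram_inv hM.hε (hf.oriented z hz) i j)
    (((h₁ i).mul (h₁ j)).add (contDiffAt_const.mul ((h₂ i).mul (h₂ j))))

lemma MinimalPatch.contDiffAt_christoffel (hy : y ∈ W) (k i j : Fin 2) :
    ContDiffAt ℝ ∞ (christoffel p X k i j) y := by
  refine hM.contDiffAt_congr_on hy (fun z hz => hM.christoffel_eq hz k i j) ?_
  exact ContDiffAt.sum fun l _ => (hM.contDiffAt_gram_inv hf hy k l).mul
    (contDiffAt_G (contDiffAt_pd (hM.smooth_pd hy j) i) (hM.smooth_pd hy l))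

lemma MinimalPatch.det_gram_ne_zero (hy : y ∈ W) : (gram p X y).det ≠ 0 := by
  intro h0
  have h := det_gram (hf.oriented y hy)
  have hε := hM.hε
  rw [h0, mul_zero] at h
  rw [← h] at hε
  norm_num at hε

/-- Lowering the upper index of the Christoffel symbols. -/
lemma MinimalPatch.christoffel_lower (hy : y ∈ W) (i j m : Fin 2) :
    christoffel p X 0 i j y * gram p X y 0 m + christoffel p X 1 i j y * gram p X y 1 m =
      G p (pd i (pd j X) y) (pd m X y) := by
  have hinv : gram p X y * (gram p X y)⁻¹ = 1 :=
    Matrix.mul_nonsing_inv _ (isUnit_iff_ne_zero.2 (hM.det_gram_ne_zero hf hy))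
  have hm : ∀ l, gram p X y 0 m * (gram p X y)⁻¹ 0 l + gram p X y 1 m * (gram p X y)⁻¹ 1 l =
      if m = l then 1 else 0 := fun l => by
    have := congrFun (congrFun hinv m) l
    rw [Matrix.mul_apply, Fin.sum_univ_two, Matrix.one_apply] at this
    rw [gram_comm p X y 0 m, gram_comm p X y 1 m]
    exact this
  rw [hM.christoffel_eq hy, hM.christoffel_eq hy, Fin.sum_univ_two, Fin.sum_univ_two]
  have h0 := hm 0
  have h1 := hm 1
  have e : G p (pd i (pd j X) y) (pd m X y) =
      (if m = 0 then 1 else 0) * G p (pd i (pd j X) y) (pd 0 X y)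
        + (if m = 1 then 1 else 0) * G p (pd i (pd j X) y) (pd 1 X y) := by
    fin_cases m <;> simp
  rw [e, ← h0, ← h1]
  ring

lemma MinimalPatch.pd_christoffel (hy : y ∈ W) (i j k m : Fin 2) :
    pd i (christoffel p X 0 j k) y * gram p X y 0 m + pd i (christoffel p X 1 j k) y * gram p X y 1 m
      + christoffel p X 0 j k y * pd i (fun z => gram p X z 0 m) y
      + christoffel p X 1 j k y * pd i (fun z => gram p X z 1 m) y =
    G p (pd i (pd j (pd k X)) y) (pd m X y) + G p (pd j (pd k X) y) (pd i (pd m X) y) := by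
  have hΓ : ∀ l, DifferentiableAt ℝ (christoffel p X l j k) y := fun l =>
    (hM.contDiffAt_christoffel hf hy l j k).differentiableAt (by simp)
  have hg : ∀ l, DifferentiableAt ℝ (fun z => gram p X z l m) y := fun l =>
    (hM.contDiffAt_gram hy l m).differentiableAt (by simp)
  have h := hM.pd_congr_on hy (fun z hz => hM.christoffel_lower hf hz j k m) i
  rw [pd_add ((hΓ 0).fun_mul (hg 0)) ((hΓ 1).fun_mul (hg 1)), pd_mul (hΓ 0) (hg 0),
    pd_mul (hΓ 1) (hg 1), pd_G
      ((contDiffAt_pd (hM.smooth_pd hy k) j).differentiableAt (by simp))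
      ((hM.smooth_pd hy m).differentiableAt (by simp))] at h
  linarith

/-- The Gauss equation in coordinates. -/
lemma MinimalPatch.riemann_lower (hy : y ∈ W) :
    ∑ l, riemann p X 0 1 1 l y * gram p X y l 0 =
      G p (pd 0 (pd 0 X) y) (pd 1 (pd 1 X) y) - G p (pd 0 (pd 1 X) y) (pd 0 (pd 1 X) y)
        - ∑ l, christoffel p X l 1 1 y * G p (pd 0 (pd 0 X) y) (pd l X y)
        + ∑ l, christoffel p X l 0 1 y * G p (pd 0 (pd 1 X) y) (pd l X y) := by
  -- The third derivatives of X in `h1` and `h2` agree, so their difference involves only second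
  -- derivatives.
  have h1 := hM.pd_christoffel hf hy 0 1 1 0
  have h2 := hM.pd_christoffel hf hy 1 0 1 0
  have h3 : pd 0 (pd 1 (pd 1 X)) y = pd 1 (pd 0 (pd 1 X)) y :=
    pd_comm (hM.smooth_pd hy 1) 0 1
  have h4 : pd 1 (pd 0 X) y = pd 0 (pd 1 X) y := pd_comm (hM.smooth y hy) 1 0
  simp only [hM.pd_gram hy, h3, h4] at h1 h2
  have l := fun i j => hM.christoffel_lower hf hy i j 0
  have l00 := l 0 0
  have l01 := l 0 1
  have l10 := l 1 0
  have l11 := l 1 1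
  rw [h4] at l10
  simp only [Fin.sum_univ_two, riemann]
  rw [G_comm p (pd 1 (pd 1 X) y) (pd 0 (pd 0 X) y)] at h1
  linear_combination h1 - h2 + christoffel p X 0 1 1 y * l00 + christoffel p X 1 1 1 y * l01
    - christoffel p X 0 0 1 y * l10 - christoffel p X 1 0 1 y * l11

/-! ### The normal projection and the Ricci equation -/

omit hM hf in
lemma normalPart_eq (z : Coord) (V : Amb) : normalPart p X z V =
    V - ip p V.1 (X z).1 • (((X z).1, 0) : Amb) - ip p V.2 (X z).2 • ((0, (X z).2) : Amb)
      - ∑ k, (∑ l, (gram p X z)⁻¹ l k * G p V (pd l X z)) • pd k X z := by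
  rw [normalPart, Finset.sum_comm]
  congr 1
  · ext i <;> simp [ambTangent]
  · exact Finset.sum_congr rfl fun k _ => (Finset.sum_smul).symm

omit hM in
lemma IsAdaptedFrame.G_normalPart (hy : y ∈ W) (V : Amb) :
    G p (normalPart p X y V) (N y) = G p V (N y) := by
  have h1 : ∀ k, G p (pd k X y) (N y) = 0 := fun k => hf.normal_N y hy _
  have h2 : G p (((X y).1, 0) : Amb) (N y) = 0 := by
    rw [G_comm, G_inl]; exact (hf.ambient_N y hy).1
  have h3 : G p ((0, (X y).2) : Amb) (N y) = 0 := by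
    rw [G_comm, G_inr, (hf.ambient_N y hy).2, neg_zero]
  rw [normalPart_eq]
  simp only [G_sub_left, G_smul_left, Fin.sum_univ_two, G_add_left, h1, h2, h3]
  ring

/-- The projection subtracts multiples of position and tangent vectors, all orthogonal to N. When it
is differentiated and paired with N, derivatives of the coefficients disappear, and only derivatives
of those vectors survive. -/
lemma MinimalPatch.G_pd_normalConn (hy : y ∈ W) (i j : Fin 2) :
    G p (pd i (normalConn p X j N') y) (N y) =
      G p (pd i (pd j N') y) (N y) + ip p (N' y).1 (pd j X y).1 * ip p (N y).1 (pd i X y).1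
        - ip p (N' y).2 (pd j X y).2 * ip p (N y).2 (pd i X y).2
        + ∑ k, ∑ l, (gram p X y)⁻¹ l k * (G p (pd j (pd l X) y) (N' y)
            * G p (pd i (pd k X) y) (N y)) := by
  have sN' := hM.smooth_N' hf hy
  have sX := hM.smooth y hy
  have sdN : ContDiffAt ℝ ∞ (pd j N') y := contDiffAt_pd sN' j
  have sα : ContDiffAt ℝ ∞ (fun z => ip p (pd j N' z).1 (X z).1) y :=
    contDiffAt_ip sdN.fst sX.fst
  have sβ : ContDiffAt ℝ ∞ (fun z => ip p (pd j N' z).2 (X z).2) y :=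
    contDiffAt_ip sdN.snd sX.snd
  have sc : ∀ k, ContDiffAt ℝ ∞ (fun z => ∑ l, (gram p X z)⁻¹ l k * G p (pd j N' z) (pd l X z)) y :=
    fun k => ContDiffAt.sum fun l _ => (hM.contDiffAt_gram_inv hf hy l k).mul
      (contDiffAt_G sdN (hM.smooth_pd hy l))
  have s1 : ContDiffAt ℝ ∞ (fun z => (((X z).1, 0) : Amb)) y := sX.fst.prodMk contDiffAt_const
  have s2 : ContDiffAt ℝ ∞ (fun z => ((0, (X z).2) : Amb)) y := contDiffAt_const.prodMk sX.snd
  have d : ∀ {E : Type} [NormedAddCommGroup E] [NormedSpace ℝ E] {f : Coord → E},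
      ContDiffAt ℝ ∞ f y → DifferentiableAt ℝ f y := fun h => h.differentiableAt (by simp)
  have h1 : ∀ k, G p (pd k X y) (N y) = 0 := fun k => hf.normal_N y hy _
  have h2 : G p (((X y).1, 0) : Amb) (N y) = 0 := by
    rw [G_comm, G_inl]; exact (hf.ambient_N y hy).1
  have h3 : G p ((0, (X y).2) : Amb) (N y) = 0 := by
    rw [G_comm, G_inr, (hf.ambient_N y hy).2, neg_zero]
  have e1 : pd i (fun z => (((X z).1, 0) : Amb)) y = ((pd i X y).1, 0) := by
    rw [pd_prodMk (d sX).fst (differentiableAt_const _), pd_fst (d sX), pd_const]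
  have e2 : pd i (fun z => ((0, (X z).2) : Amb)) y = (0, (pd i X y).2) := by
    rw [pd_prodMk (differentiableAt_const _) (d sX).snd, pd_snd (d sX), pd_const]
  have hA : ip p (pd j N' y).1 (X y).1 = -ip p (N' y).1 (pd j X y).1 :=
    hM.ip_pd_fst hy (d sN') (fun z hz => (hf.ambient_N' z hz).1) j
  have hB : ip p (pd j N' y).2 (X y).2 = -ip p (N' y).2 (pd j X y).2 :=
    hM.ip_pd_snd hy (d sN') (fun z hz => (hf.ambient_N' z hz).2) j
  have hC : ∀ l, G p (pd j N' y) (pd l X y) = -G p (pd j (pd l X) y) (N' y) := fun l => by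
    rw [G_comm p (pd j (pd l X) y)]
    exact hM.G_pd hy (d sN') (d (hM.smooth_pd hy l))
      (fun z hz => by rw [G_comm]; exact hf.normal_N' z hz _) j
  have hexp : ∀ z, normalConn p X j N' z = pd j N' z
      - ip p (pd j N' z).1 (X z).1 • (((X z).1, 0) : Amb)
      - ip p (pd j N' z).2 (X z).2 • ((0, (X z).2) : Amb)
      - ((∑ l, (gram p X z)⁻¹ l 0 * G p (pd j N' z) (pd l X z)) • pd 0 X z
        + (∑ l, (gram p X z)⁻¹ l 1 * G p (pd j N' z) (pd l X z)) • pd 1 X z) := fun z => by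
    rw [normalConn, normalPart_eq, Fin.sum_univ_two (f := fun k => (∑ l, _) • pd k X z)]
  have t1 := contDiffAt_fun_smul sα s1
  have t2 := contDiffAt_fun_smul sβ s2
  have t3 := contDiffAt_fun_smul (sc 0) (hM.smooth_pd hy 0)
  have t4 := contDiffAt_fun_smul (sc 1) (hM.smooth_pd hy 1)
  rw [hM.pd_congr_on hy (fun z _ => hexp z) i, pd_sub (d ((sdN.sub t1).sub t2)) (d (t3.add t4)),
    pd_sub (d (sdN.sub t1)) (d t2), pd_sub (d sdN) (d t1), pd_add (d t3) (d t4),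
    pd_smul (d sα) (d s1), pd_smul (d sβ) (d s2), pd_smul (d (sc 0)) (d (hM.smooth_pd hy 0)),
    pd_smul (d (sc 1)) (d (hM.smooth_pd hy 1)), e1, e2]
  simp only [G_sub_left, G_add_left, G_smul_left, h1, h2, h3, hA, hB, hC, Fin.sum_univ_two]
  rw [G_comm p ((pd i X y).1, 0), G_inl, G_comm p (0, (pd i X y).2), G_inr]
  ring

/-- The Ricci equation in coordinates. -/
lemma MinimalPatch.ricci (hy : y ∈ W) :
    G p (normalCurvTensor p X N' y) (N y) =
      ∑ k, ∑ l, (gram p X y)⁻¹ l k *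
        (G p (pd 1 (pd l X) y) (N' y) * G p (pd 0 (pd k X) y) (N y)
          - G p (pd 0 (pd l X) y) (N' y) * G p (pd 1 (pd k X) y) (N y)) := by
  -- G-orthogonality makes the scalar products in the two factors equal, so the ambient
  -- contributions cancel.
  have h1 : ∀ k, ip p (N y).1 (pd k X y).1 = ip p (N y).2 (pd k X y).2 := fun k => by
    have : G p (pd k X y) (N y) = 0 := hf.normal_N y hy _
    rw [G_comm] at this
    exact sub_eq_zero.1 this
  have h2 : ∀ k, ip p (N' y).1 (pd k X y).1 = ip p (N' y).2 (pd k X y).2 := fun k => by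
    have : G p (pd k X y) (N' y) = 0 := hf.normal_N' y hy _
    rw [G_comm] at this
    exact sub_eq_zero.1 this
  have h3 : pd 0 (pd 1 N') y = pd 1 (pd 0 N') y := pd_comm (hM.smooth_N' hf hy) 0 1
  rw [normalCurvTensor, G_sub_left, normalConn, normalConn, hf.G_normalPart hy,
    hf.G_normalPart hy, hM.G_pd_normalConn hf hy, hM.G_pd_normalConn hf hy, h3]
  simp only [h1, h2, Fin.sum_univ_two]
  ring

end Patch

/-! ### Derivatives of the frame -/

section Patch

variable {p : ℕ} {ε b : ℝ} {X : Coord → Amb} {C : Fin 2 → Coord → ℝ} {W : Set Coord}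
  {e₁ e₂ e e' : Coord → Coord} {N N' : Coord → Amb} {y : Coord}
  (hM : MinimalPatch p ε X C W) (hf : IsAdaptedFrame p ε b X C W e₁ e₂ N N')

/-- The component along `ν` of the second fundamental form. -/
lemma MinimalPatch.G_pd_push (hM : MinimalPatch p ε X C W) (hy : y ∈ W) (he : ContDiffAt ℝ ∞ e y)
    {ν : Coord → Amb} (hν : ContDiffAt ℝ ∞ ν y)
    (h : ∀ z ∈ W, ∀ a : Coord, G p (fderiv ℝ X z a) (ν z) = 0) (i : Fin 2) :
    G p (pd i (push X e) y) (ν y) = e y 0 * G p (pd i (pd 0 X) y) (ν y)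
      + e y 1 * G p (pd i (pd 1 X) y) (ν y) := by
  have dν : DifferentiableAt ℝ ν y := hν.differentiableAt (by simp)
  have h1 : ∀ k, G p (pd i (pd k X) y) (ν y) = -G p (pd k X y) (pd i ν y) := fun k =>
    hM.G_pd hy ((hM.smooth_pd hy k).differentiableAt (by simp)) dν (fun z hz => h z hz _) i
  rw [hM.G_pd hy ((hM.contDiffAt_push hy he).differentiableAt (by simp)) dν
    (fun z hz => h z hz _) i, h1, h1, push_eq, G_add_left, G_smul_left, G_smul_left]
  ring

lemma MinimalPatch.G_fderiv_push (hM : MinimalPatch p ε X C W) (hy : y ∈ W)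
    (he : ContDiffAt ℝ ∞ e y)
    {ν : Coord → Amb} (hν : ContDiffAt ℝ ∞ ν y)
    (h : ∀ z ∈ W, ∀ a : Coord, G p (fderiv ℝ X z a) (ν z) = 0) (a : Coord) :
    G p (fderiv ℝ (push X e) y a) (ν y) =
      a 0 * e y 0 * G p (pd 0 (pd 0 X) y) (ν y)
      + (a 0 * e y 1 + a 1 * e y 0) * G p (pd 0 (pd 1 X) y) (ν y)
      + a 1 * e y 1 * G p (pd 1 (pd 1 X) y) (ν y) := by
  rw [fderiv_eq_sum_pd, G_add_left, G_smul_left, G_smul_left, hM.G_pd_push hy he hν h,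
    hM.G_pd_push hy he hν h, pd_comm (hM.smooth y hy) 1 0]
  ring

lemma MinimalPatch.G_fderiv (hM : MinimalPatch p ε X C W) (hy : y ∈ W) {U V : Coord → Amb}
    (hU : ContDiffAt ℝ ∞ U y) (hV : ContDiffAt ℝ ∞ V y) {c : ℝ}
    (h : ∀ z ∈ W, G p (U z) (V z) = c) (a : Coord) :
    G p (fderiv ℝ U y a) (V y) = -G p (fderiv ℝ V y a) (U y) := by
  have dU : DifferentiableAt ℝ U y := hU.differentiableAt (by simp)
  have dV : DifferentiableAt ℝ V y := hV.differentiableAt (by simp)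
  rw [fderiv_eq_sum_pd, fderiv_eq_sum_pd, G_add_left, G_smul_left, G_smul_left, G_add_left,
    G_smul_left, G_smul_left, hM.G_pd hy dU dV h, hM.G_pd hy dU dV h, G_comm p (U y),
    G_comm p (U y)]
  ring

lemma MinimalPatch.fderiv_push_fst (hM : MinimalPatch p ε X C W) (hy : y ∈ W)
    (he : ContDiffAt ℝ ∞ e y) :
    ip p (fderiv ℝ (push X e) y (e' y)).1 (X y).1 = -ip p (push X e' y).1 (push X e y).1 := by
  have d : DifferentiableAt ℝ (push X e) y := (hM.contDiffAt_push hy he).differentiableAt (by simp)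
  have h := hM.ip_pd_fst hy d (fun z hz => hM.push_fst hz e)
  rw [fderiv_eq_sum_pd, push_eq e', Prod.fst_add, Prod.smul_fst, Prod.smul_fst, ip_add_left,
    ip_smul_left, ip_smul_left, h, h, Prod.fst_add, Prod.smul_fst, Prod.smul_fst, ip_add_left,
    ip_smul_left, ip_smul_left, ip_comm p (push X e y).1, ip_comm p (push X e y).1]
  ring

lemma MinimalPatch.fderiv_push_snd (hM : MinimalPatch p ε X C W) (hy : y ∈ W)
    (he : ContDiffAt ℝ ∞ e y) :
    ip p (fderiv ℝ (push X e) y (e' y)).2 (X y).2 = -ip p (push X e' y).2 (push X e y).2 := by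
  have d : DifferentiableAt ℝ (push X e) y := (hM.contDiffAt_push hy he).differentiableAt (by simp)
  have h := hM.ip_pd_snd hy d (fun z hz => hM.push_snd hz e)
  rw [fderiv_eq_sum_pd, push_eq e', Prod.snd_add, Prod.smul_snd, Prod.smul_snd, ip_add_left,
    ip_smul_left, ip_smul_left, h, h, Prod.snd_add, Prod.smul_snd, Prod.smul_snd, ip_add_left,
    ip_smul_left, ip_smul_left, ip_comm p (push X e y).2, ip_comm p (push X e y).2]
  ring

include hM hf

lemma MinimalPatch.trace_secondFF (hy : y ∈ W) {ν : Coord → Amb}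
    (hν : ∀ V, G p (normalPart p X y V) (ν y) = G p V (ν y)) :
    (e₁ y 0 * e₁ y 0 + ε * (e₂ y 0 * e₂ y 0)) * G p (pd 0 (pd 0 X) y) (ν y)
      + 2 * (e₁ y 0 * e₁ y 1 + ε * (e₂ y 0 * e₂ y 1)) * G p (pd 0 (pd 1 X) y) (ν y)
      + (e₁ y 1 * e₁ y 1 + ε * (e₂ y 1 * e₂ y 1)) * G p (pd 1 (pd 1 X) y) (ν y) = 0 := by
  have h := congrArg (fun V => G p V (ν y)) (hM.minimal y hy)
  have h0 : G p 0 (ν y) = 0 := by simp [← neutralBilin_apply]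
  simp only [meanCurvature, Fin.sum_univ_two, secondFF, gram_inv hM.hε (hf.oriented y hy),
    G_add_left, G_smul_left, hν, h0, pd_comm (hM.smooth y hy) 1 0] at h
  linarith

omit hM in
lemma IsAdaptedFrame.G_normalPart' (hy : y ∈ W) (V : Amb) :
    G p (normalPart p X y V) (N' y) = G p V (N' y) := by
  have h1 : ∀ k, G p (pd k X y) (N' y) = 0 := fun k => hf.normal_N' y hy _
  have h2 : G p (((X y).1, 0) : Amb) (N' y) = 0 := by
    rw [G_comm, G_inl]; exact (hf.ambient_N' y hy).1
  have h3 : G p ((0, (X y).2) : Amb) (N' y) = 0 := by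
    rw [G_comm, G_inr, (hf.ambient_N' y hy).2, neg_zero]
  rw [normalPart_eq]
  simp only [G_sub_left, G_smul_left, Fin.sum_univ_two, G_add_left, h1, h2, h3]
  ring

/-- The derivative of the frame along itself. -/
lemma MinimalPatch.frameDerivative (hy : y ∈ W) :
    FrameDerivative p ε (X y) (push X e₁ y) (push X e₂ y) (N y) (N' y)
      (fderiv ℝ (push X e₁) y (e₁ y)) (fderiv ℝ (push X e₂) y (e₁ y))
      (fderiv ℝ (push X e₁) y (e₂ y)) (fderiv ℝ (push X e₂) y (e₂ y))
      (G p (fderiv ℝ (push X e₁) y (e₁ y)) (push X e₂ y))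
      (G p (fderiv ℝ (push X e₁) y (e₂ y)) (push X e₂ y))
      (G p (fderiv ℝ (push X e₁) y (e₁ y)) (N y))
      (G p (fderiv ℝ (push X e₂) y (e₁ y)) (N y))
      (G p (fderiv ℝ (push X e₁) y (e₁ y)) (N' y))
      (G p (fderiv ℝ (push X e₂) y (e₁ y)) (N' y)) := by
  have s1 := hM.smooth_e₁ hf hy
  have s2 := hM.smooth_e₂ hf hy
  have sN := hM.smooth_N hf hy
  have sN' := hM.smooth_N' hf hy
  have p1 := hM.contDiffAt_push hy s1
  have p2 := hM.contDiffAt_push hy s2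
  have g11 := hM.G_fderiv hy p1 p1 (fun z hz => (hf.oriented z hz).1)
  have g12 := hM.G_fderiv hy p2 p1 (c := 0) (fun z hz => by
    rw [G_comm]; exact (hf.oriented z hz).2.1)
  have g22 := hM.G_fderiv hy p2 p2 (fun z hz => (hf.oriented z hz).2.2.1)
  have n1 := hM.G_fderiv_push hy s1 sN hf.normal_N
  have n2 := hM.G_fderiv_push hy s2 sN hf.normal_N
  have n1' := hM.G_fderiv_push hy s1 sN' hf.normal_N'
  have n2' := hM.G_fderiv_push hy s2 sN' hf.normal_N'
  have T := hM.trace_secondFF hf hy (hf.G_normalPart hy)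
  have T' := hM.trace_secondFF hf hy (hf.G_normalPart' hy)
  have hε := hM.hε
  exact
  { t₁₁ := by linarith [g11 (e₁ y)]
    t₁₂ := rfl
    t₂₁ := g12 (e₁ y)
    t₂₂ := by linarith [g22 (e₁ y)]
    t₁₁' := by linarith [g11 (e₂ y)]
    t₁₂' := rfl
    t₂₁' := g12 (e₂ y)
    t₂₂' := by linarith [g22 (e₂ y)]
    f₁₁ := rfl
    f₁₂ := rfl
    f₂₁ := by rw [n1, n2]; ring
    f₂₂ := by
      rw [n1, n2]
      -- The vanishing trace says h(E₁, E₁) + ε h(E₂, E₂) = 0; multiplying by ε isolates the second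
      -- term.
      linear_combination ε * T - (e₂ y 0 * e₂ y 0 * G p (pd 0 (pd 0 X) y) (N y)
        + 2 * e₂ y 0 * e₂ y 1 * G p (pd 0 (pd 1 X) y) (N y)
        + e₂ y 1 * e₂ y 1 * G p (pd 1 (pd 1 X) y) (N y)) * hε
    f₁₁' := rfl
    f₁₂' := rfl
    f₂₁' := by rw [n1', n2']; ring
    f₂₂' := by
      rw [n1', n2']
      linear_combination ε * T' - (e₂ y 0 * e₂ y 0 * G p (pd 0 (pd 0 X) y) (N' y)
        + 2 * e₂ y 0 * e₂ y 1 * G p (pd 0 (pd 1 X) y) (N' y)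
        + e₂ y 1 * e₂ y 1 * G p (pd 1 (pd 1 X) y) (N' y)) * hε
    x₁₁ := hM.fderiv_push_fst hy s1
    x₁₂ := hM.fderiv_push_fst hy s2
    x₂₁ := by rw [hM.fderiv_push_fst hy s1, ip_comm]
    x₂₂ := hM.fderiv_push_fst hy s2
    x₁₁' := hM.fderiv_push_snd hy s1
    x₁₂' := hM.fderiv_push_snd hy s2
    x₂₁' := by rw [hM.fderiv_push_snd hy s1, ip_comm]
    x₂₂' := hM.fderiv_push_snd hy s2 }

/-- The Gauss equation in an adapted frame. -/
lemma MinimalPatch.gauss (hb : b * b = 1) (hy : y ∈ W) :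
    ε * gaussCurvature p X y =
      b * (G p (fderiv ℝ (push X e₁) y (e₁ y)) (N y) ^ 2
        + ε * G p (fderiv ℝ (push X e₁) y (e₁ y)) (N' y) ^ 2
        + ε * G p (fderiv ℝ (push X e₂) y (e₁ y)) (N y) ^ 2
        + G p (fderiv ℝ (push X e₂) y (e₁ y)) (N' y) ^ 2) + (-1) ^ p * (C 0 y * C 1 y) := by
  obtain ⟨r, s, h⟩ := hM.adaptedPoint hf hb hy
  have d := hM.frameDerivative hf hy
  have hε := hM.hε
  have hdet := det_gram (hf.oriented y hy)
  have hε0 : ε ≠ 0 := by rintro rfl; simp at hε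
  have hΓ : ∀ U : Amb, ∀ i j, ∑ l, christoffel p X l i j y * G p U (pd l X y) =
      G p (pd i (pd j X) y) (push X e₁ y) * G p U (push X e₁ y)
        + ε * (G p (pd i (pd j X) y) (push X e₂ y) * G p U (push X e₂ y)) := by
    intro U i j
    simp only [hM.christoffel_eq hy, gram_inv hε (hf.oriented y hy), Fin.sum_univ_two, push_eq,
      G_add_right, G_smul_right]
    ring
  have hnum := hM.riemann_lower hf hy
  have x1 : ∀ i j, ip p (pd i (pd j X) y).1 (X y).1 = -ip p (pd j X y).1 (pd i X y).1 :=
    fun i j => hM.ip_pd_fst hy ((hM.smooth_pd hy j).differentiableAt (by simp))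
      (fun z hz => hM.tangent_fst hz j) i
  have x2 : ∀ i j, ip p (pd i (pd j X) y).2 (X y).2 = -ip p (pd j X y).2 (pd i X y).2 :=
    fun i j => hM.ip_pd_snd hy ((hM.smooth_pd hy j).differentiableAt (by simp))
      (fun z hz => hM.tangent_snd hz j) i
  rw [hΓ, hΓ, h.G_expansion (pd 0 (pd 0 X) y), h.G_expansion (pd 0 (pd 1 X) y), x1, x1, x1, x2, x2,
    x2, ip_comm p (pd 1 X y).1 (pd 0 X y).1, ip_comm p (pd 1 X y).2 (pd 0 X y).2] at hnum
  have hgauss : ε * gaussCurvature p X y = coordDet (e₁ y) (e₂ y) ^ 2 *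
      ∑ l, riemann p X 0 1 1 l y * gram p X y l 0 := by
    have hd0 := hM.det_gram_ne_zero hf hy
    rw [gaussCurvature, ← mul_div_assoc, div_eq_iff hd0]
    linear_combination -(∑ l, riemann p X 0 1 1 l y * gram p X y l 0) * hdet
  rw [hgauss, hnum]
  -- The determinant of a symmetric bilinear form scales by `coordDet` squared on passing from the
  -- coordinate basis to the frame. This also gives `q3` and `q4` for the factor metrics.
  have quad : ∀ {ν : Coord → Amb}, ContDiffAt ℝ ∞ ν y →
      (∀ z ∈ W, ∀ a : Coord, G p (fderiv ℝ X z a) (ν z) = 0) →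
      coordDet (e₁ y) (e₂ y) ^ 2 * (G p (pd 0 (pd 0 X) y) (ν y) * G p (pd 1 (pd 1 X) y) (ν y)
        - G p (pd 0 (pd 1 X) y) (ν y) * G p (pd 0 (pd 1 X) y) (ν y)) =
      G p (fderiv ℝ (push X e₁) y (e₁ y)) (ν y) * G p (fderiv ℝ (push X e₂) y (e₂ y)) (ν y)
        - G p (fderiv ℝ (push X e₂) y (e₁ y)) (ν y) ^ 2 := by
    intro ν hν hn
    rw [hM.G_fderiv_push hy (hM.smooth_e₁ hf hy) hν hn,
      hM.G_fderiv_push hy (hM.smooth_e₂ hf hy) hν hn,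
      hM.G_fderiv_push hy (hM.smooth_e₂ hf hy) hν hn, coordDet]
    ring
  have q1 := quad (hM.smooth_N hf hy) hf.normal_N
  have q2 := quad (hM.smooth_N' hf hy) hf.normal_N'
  rw [d.f₂₂] at q1
  rw [d.f₂₂'] at q2
  have q3 : coordDet (e₁ y) (e₂ y) ^ 2 *
      (ip p (pd 0 X y).1 (pd 0 X y).1 * ip p (pd 1 X y).1 (pd 1 X y).1
        - ip p (pd 0 X y).1 (pd 1 X y).1 ^ 2) =
      ip p (push X e₁ y).1 (push X e₁ y).1 * ip p (push X e₂ y).1 (push X e₂ y).1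
        - ip p (push X e₁ y).1 (push X e₂ y).1 ^ 2 := by
    simp only [push_eq, Prod.fst_add, Prod.smul_fst, ip_add_left, ip_add_right, ip_smul_left,
      ip_smul_right, ip_comm p (pd 1 X y).1 (pd 0 X y).1, coordDet]
    ring
  have q4 : coordDet (e₁ y) (e₂ y) ^ 2 *
      (ip p (pd 0 X y).2 (pd 0 X y).2 * ip p (pd 1 X y).2 (pd 1 X y).2
        - ip p (pd 0 X y).2 (pd 1 X y).2 ^ 2) =
      ip p (push X e₁ y).2 (push X e₁ y).2 * ip p (push X e₂ y).2 (push X e₂ y).2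
        - ip p (push X e₁ y).2 (push X e₂ y).2 ^ 2 := by
    simp only [push_eq, Prod.snd_add, Prod.smul_snd, ip_add_left, ip_add_right, ip_smul_left,
      ip_smul_right, ip_comm p (pd 1 X y).2 (pd 0 X y).2, coordDet]
    ring
  have hA := h.ambient_curvature
  linear_combination -ε * b * q1 - b * q2 + q3 - q4 + hA
    + b * G p (fderiv ℝ (push X e₁) y (e₁ y)) (N y) ^ 2 * hε

/-- The Ricci equation in an adapted frame. -/
lemma MinimalPatch.normalCurvature_eq (hy : y ∈ W) :
    normalCurvature p X e₁ e₂ N N' y =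
      2 * (G p (fderiv ℝ (push X e₂) y (e₁ y)) (N' y) * G p (fderiv ℝ (push X e₁) y (e₁ y)) (N y)
        - G p (fderiv ℝ (push X e₁) y (e₁ y)) (N' y)
          * G p (fderiv ℝ (push X e₂) y (e₁ y)) (N y)) := by
  have d := hM.frameDerivative hf hy
  have hε := hM.hε
  have s1 := hM.smooth_e₁ hf hy
  have s2 := hM.smooth_e₂ hf hy
  have sN := hM.smooth_N hf hy
  have sN' := hM.smooth_N' hf hy
  have n1 := hM.G_fderiv_push hy s1 sN hf.normal_N
  have n2 := hM.G_fderiv_push hy s2 sN hf.normal_N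
  have n1' := hM.G_fderiv_push hy s1 sN' hf.normal_N'
  have n2' := hM.G_fderiv_push hy s2 sN' hf.normal_N'
  have key : normalCurvature p X e₁ e₂ N N' y =
      G p (fderiv ℝ (push X e₁) y (e₂ y)) (N' y) * G p (fderiv ℝ (push X e₁) y (e₁ y)) (N y)
      - G p (fderiv ℝ (push X e₁) y (e₁ y)) (N' y) * G p (fderiv ℝ (push X e₁) y (e₂ y)) (N y)
      + ε * (G p (fderiv ℝ (push X e₂) y (e₂ y)) (N' y)
          * G p (fderiv ℝ (push X e₂) y (e₁ y)) (N y)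
        - G p (fderiv ℝ (push X e₂) y (e₁ y)) (N' y)
          * G p (fderiv ℝ (push X e₂) y (e₂ y)) (N y)) := by
    rw [normalCurvature, hM.ricci hf hy, n1, n1, n2, n2, n1', n1', n2', n2', coordDet]
    simp only [Fin.sum_univ_two, gram_inv hε (hf.oriented y hy), pd_comm (hM.smooth y hy) 1 0]
    ring
  rw [key, d.f₂₁', d.f₂₁, d.f₂₂, d.f₂₂']
  linear_combination (G p (fderiv ℝ (push X e₂) y (e₁ y)) (N' y)
    * G p (fderiv ℝ (push X e₁) y (e₁ y)) (N y) - G p (fderiv ℝ (push X e₁) y (e₁ y)) (N' y)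
    * G p (fderiv ℝ (push X e₂) y (e₁ y)) (N y)) * hε

end Patch

/-! ### Derivatives of the Kähler functions -/

lemma Om_push_base (p : ℕ) (k : Fin 2) (X : Coord → Amb) (e : Coord → Coord) (y : Coord)
    (V U : Amb) : Om p k (push X e y) V U =
      e y 0 * Om p k (pd 0 X y) V U + e y 1 * Om p k (pd 1 X y) V U := by
  have : ∀ Z, Om p k Z V U = G p (JBilin p k Z V) U := fun Z => Om_eq p k Z V U
  simp only [this, push_eq, map_add, map_smul, add_apply, smul_apply, G_add_left, G_smul_left]

section Patch

variable {p : ℕ} {ε b : ℝ} {X : Coord → Amb} {C : Fin 2 → Coord → ℝ} {W : Set Coord}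
  {e₁ e₂ : Coord → Coord} {N N' : Coord → Amb} {y : Coord}
  (hM : MinimalPatch p ε X C W) (hf : IsAdaptedFrame p ε b X C W e₁ e₂ N N')

include hM hf

lemma MinimalPatch.contDiffAt_kahler (hy : y ∈ W) (k : Fin 2) : ContDiffAt ℝ ∞ (C k) y := by
  refine hM.contDiffAt_congr_on hy (fun z hz => hM.kahler_frame hf hz k) ?_
  simp only [Om_eq]
  exact contDiffAt_const.mul (contDiffAt_G (contDiffAt_J (hM.smooth y hy)
    (hM.contDiffAt_push hy (hM.smooth_e₁ hf hy))) (hM.contDiffAt_push hy (hM.smooth_e₂ hf hy)))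

/-- Parallelism of J_k takes the form `base`: differentiating the base point yields ω on three
tangent vectors of a plane, which vanishes in each factor. -/
lemma MinimalPatch.pd_kahler (hy : y ∈ W) (k i : Fin 2) :
    pd i (C k) y = ε * (Om p k (X y) (pd i (push X e₁) y) (push X e₂ y)
      + Om p k (X y) (push X e₁ y) (pd i (push X e₂) y)) := by
  have s1 := hM.contDiffAt_push hy (hM.smooth_e₁ hf hy)
  have s2 := hM.contDiffAt_push hy (hM.smooth_e₂ hf hy)
  have sJ := contDiffAt_J (p := p) (k := k) (hM.smooth y hy) s1
  have d1 : DifferentiableAt ℝ (push X e₁) y := s1.differentiableAt (by simp)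
  have d2 : DifferentiableAt ℝ (push X e₂) y := s2.differentiableAt (by simp)
  have dJ := sJ.differentiableAt (by simp)
  have dG := (contDiffAt_G (p := p) sJ s2).differentiableAt (by simp)
  have base : Om p k (pd i X y) (push X e₁ y) (push X e₂ y) = 0 := by
    rw [Om, omega_tangent (hM.mem y hy).1 (hM.tangent_fst hy i) (hM.push_fst hy e₁)
      (hM.push_fst hy e₂), omega_tangent (hM.mem y hy).2 (hM.tangent_snd hy i)
      (hM.push_snd hy e₁) (hM.push_snd hy e₂)]
    ring
  rw [hM.pd_congr_on hy (fun z hz => hM.kahler_frame hf hz k)]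
  simp only [Om_eq] at base ⊢
  rw [pd_const_mul ε dG, pd_G dJ d2, pd_J (hM.diff hy) d1, G_add_left, base, zero_add]

lemma MinimalPatch.fderiv_kahler (hy : y ∈ W) (k : Fin 2) (a : Coord) :
    a 0 * pd 0 (C k) y + a 1 * pd 1 (C k) y =
      ε * (Om p k (X y) (fderiv ℝ (push X e₁) y a) (push X e₂ y)
      + Om p k (X y) (push X e₁ y) (fderiv ℝ (push X e₂) y a)) := by
  rw [hM.pd_kahler hf hy, hM.pd_kahler hf hy, fderiv_eq_sum_pd, fderiv_eq_sum_pd]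
  simp only [Om_add_left, Om_add_right, Om_smul_left, Om_smul_right]
  ring

/-! ### Gradient, dual 1-form and Laplacian -/

lemma MinimalPatch.gradNormSq_eq (hy : y ∈ W) (k : Fin 2) :
    gradNormSq p X (C k) y =
      (ε * (Om p k (X y) (fderiv ℝ (push X e₁) y (e₁ y)) (push X e₂ y)
        + Om p k (X y) (push X e₁ y) (fderiv ℝ (push X e₂) y (e₁ y)))) ^ 2
      + ε * (ε * (Om p k (X y) (fderiv ℝ (push X e₁) y (e₂ y)) (push X e₂ y)
        + Om p k (X y) (push X e₁ y) (fderiv ℝ (push X e₂) y (e₂ y)))) ^ 2 := by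
  have ho := hf.oriented y hy
  have hε := hM.hε
  have c1 := hM.fderiv_kahler hf hy k (e₁ y)
  have c2 := hM.fderiv_kahler hf hy k (e₂ y)
  rw [← c1, ← c2]
  obtain ⟨h1, h2, h3, -⟩ := ho
  have hg : ∀ i, grad p X (C k) y i =
      e₁ y i * (e₁ y 0 * pd 0 (C k) y + e₁ y 1 * pd 1 (C k) y)
        + ε * e₂ y i * (e₂ y 0 * pd 0 (C k) y + e₂ y 1 * pd 1 (C k) y) := fun i => by
    simp only [grad, Fin.sum_univ_two, gram_inv hε (hf.oriented y hy)]
    ring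
  simp only [gradNormSq, Fin.sum_univ_two, hg]
  rw [gForm_eq] at h1 h2 h3
  rw [gram_comm p X y 1 0]
  set a := e₁ y 0 * pd 0 (C k) y + e₁ y 1 * pd 1 (C k) y
  set c := e₂ y 0 * pd 0 (C k) y + e₂ y 1 * pd 1 (C k) y
  linear_combination a ^ 2 * h1 + 2 * ε * a * c * h2 + c ^ 2 * h3 * (ε * ε) + ε * c ^ 2 * hε

/-- The 1-form dual to the differential of the Kähler function. -/
noncomputable def dualForm (p : ℕ) (ε : ℝ) (X : Coord → Amb) (c : Coord → ℝ)
    (e₁ e₂ : Coord → Coord) (k j : Fin 2) (y : Coord) : ℝ :=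
  2 * (c y * G p (pd j (push X e₁) y) (push X e₂ y))
    - (G p (pd j (push X e₁) y) (J p k (X y) (push X e₁ y))
      + ε * G p (pd j (push X e₂) y) (J p k (X y) (push X e₂ y)))

/-- The Hodge star of dC_k is β up to sign. In the frame this is `dual_first` and `dual_second`,
where minimality enters. -/
lemma MinimalPatch.sqrt_mul_grad (hb : b * b = 1) (hy : y ∈ W) (k : Fin 2) :
    Real.sqrt |(gram p X y).det| * grad p X (C k) y 0 =
        -(ε * dualForm p ε X (C k) e₁ e₂ k 1 y) ∧
      Real.sqrt |(gram p X y).det| * grad p X (C k) y 1 =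
        ε * dualForm p ε X (C k) e₁ e₂ k 0 y := by
  obtain ⟨r, s, h⟩ := hM.adaptedPoint hf hb hy
  have d := hM.frameDerivative hf hy
  have ho := hf.oriented y hy
  have hε := hM.hε
  have hpos : coordDet (e₁ y) (e₂ y) ≠ 0 := ho.2.2.2.ne'
  have c1 := hM.fderiv_kahler hf hy k (e₁ y)
  have c2 := hM.fderiv_kahler hf hy k (e₂ y)
  rw [h.dual_first d k] at c1
  rw [h.dual_second d k] at c2
  have hg : ∀ i, grad p X (C k) y i =
      e₁ y i * (e₁ y 0 * pd 0 (C k) y + e₁ y 1 * pd 1 (C k) y)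
        + ε * e₂ y i * (e₂ y 0 * pd 0 (C k) y + e₂ y 1 * pd 1 (C k) y) := fun i => by
    simp only [grad, Fin.sum_univ_two, gram_inv hε ho]
    ring
  have hβ : ∀ e : Coord → Coord,
      -(Om p k (X y) (push X e₁ y) (fderiv ℝ (push X e₁) y (e y))
          + ε * Om p k (X y) (push X e₂ y) (fderiv ℝ (push X e₂) y (e y)))
        + 2 * C k y * G p (fderiv ℝ (push X e₁) y (e y)) (push X e₂ y) =
      e y 0 * dualForm p ε X (C k) e₁ e₂ k 0 y + e y 1 * dualForm p ε X (C k) e₁ e₂ k 1 y := by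
    intro e
    simp only [dualForm, fderiv_eq_sum_pd _ (e y), Om_add_right, Om_smul_right, G_add_left,
      G_smul_left]
    simp only [Om_eq, G_comm p (J p k (X y) _)]
    ring
  rw [hβ] at c1 c2
  rw [sqrt_det_gram hε ho, hg, hg, c1, c2]
  constructor <;> field_simp <;> rw [coordDet] <;> ring

/-- The exterior derivative of the dual form. -/
lemma MinimalPatch.d_dualForm (hy : y ∈ W) (k : Fin 2) :
    pd 0 (dualForm p ε X (C k) e₁ e₂ k 1) y - pd 1 (dualForm p ε X (C k) e₁ e₂ k 0) y =
      -(2 * Om p k (X y) (pd 0 (push X e₁) y) (pd 1 (push X e₁) y)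
          + (Om p k (pd 0 X y) (push X e₁ y) (pd 1 (push X e₁) y)
            - Om p k (pd 1 X y) (push X e₁ y) (pd 0 (push X e₁) y))
          + ε * (2 * Om p k (X y) (pd 0 (push X e₂) y) (pd 1 (push X e₂) y)
            + (Om p k (pd 0 X y) (push X e₂ y) (pd 1 (push X e₂) y)
              - Om p k (pd 1 X y) (push X e₂ y) (pd 0 (push X e₂) y))))
        + 2 * (pd 0 (C k) y * G p (pd 1 (push X e₁) y) (push X e₂ y)
          - pd 1 (C k) y * G p (pd 0 (push X e₁) y) (push X e₂ y))
        + 2 * C k y * (G p (pd 1 (push X e₁) y) (pd 0 (push X e₂) y)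
          - G p (pd 0 (push X e₁) y) (pd 1 (push X e₂) y)) := by
  have s1 := hM.contDiffAt_push hy (hM.smooth_e₁ hf hy)
  have s2 := hM.contDiffAt_push hy (hM.smooth_e₂ hf hy)
  have sC := hM.contDiffAt_kahler hf hy k
  have sJ1 := contDiffAt_J (p := p) (k := k) (hM.smooth y hy) s1
  have sJ2 := contDiffAt_J (p := p) (k := k) (hM.smooth y hy) s2
  have d : ∀ {E : Type} [NormedAddCommGroup E] [NormedSpace ℝ E] {f : Coord → E},
      ContDiffAt ℝ ∞ f y → DifferentiableAt ℝ f y := fun h => h.differentiableAt (by simp)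
  have key : ∀ i j, pd i (dualForm p ε X (C k) e₁ e₂ k j) y =
      2 * (pd i (C k) y * G p (pd j (push X e₁) y) (push X e₂ y)
        + C k y * (G p (pd i (pd j (push X e₁)) y) (push X e₂ y)
          + G p (pd j (push X e₁) y) (pd i (push X e₂) y)))
      - ((G p (pd i (pd j (push X e₁)) y) (J p k (X y) (push X e₁ y))
          + G p (pd j (push X e₁) y) (J p k (pd i X y) (push X e₁ y)
            + J p k (X y) (pd i (push X e₁) y)))
        + ε * (G p (pd i (pd j (push X e₂)) y) (J p k (X y) (push X e₂ y))
          + G p (pd j (push X e₂) y) (J p k (pd i X y) (push X e₂ y)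
            + J p k (X y) (pd i (push X e₂) y)))) := by
    intro i j
    have t1 := contDiffAt_pd s1 j
    have t2 := contDiffAt_pd s2 j
    have g1 := contDiffAt_G (p := p) t1 s2
    have g2 := contDiffAt_G (p := p) t1 sJ1
    have g3 := contDiffAt_G (p := p) t2 sJ2
    have m1 : ContDiffAt ℝ ∞ (fun z => C k z * G p (pd j (push X e₁) z) (push X e₂ z)) y :=
      sC.mul g1
    have m3 : ContDiffAt ℝ ∞
        (fun z => ε * G p (pd j (push X e₂) z) (J p k (X z) (push X e₂ z))) y :=
      contDiffAt_const.mul g3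
    have m2 : ContDiffAt ℝ ∞
        (fun z => 2 * (C k z * G p (pd j (push X e₁) z) (push X e₂ z))) y :=
      contDiffAt_const.mul m1
    change pd i (fun z => 2 * (C k z * G p (pd j (push X e₁) z) (push X e₂ z))
      - (G p (pd j (push X e₁) z) (J p k (X z) (push X e₁ z))
        + ε * G p (pd j (push X e₂) z) (J p k (X z) (push X e₂ z)))) y = _
    rw [pd_sub (d m2) (d (g2.add m3)), pd_const_mul _ (d m1), pd_mul (d sC) (d g1),
      pd_G (d t1) (d s2), pd_add (d g2) (d m3), pd_const_mul _ (d g3), pd_G (d t1) (d sJ1),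
      pd_G (d t2) (d sJ2), pd_J (hM.diff hy) (d s1), pd_J (hM.diff hy) (d s2)]
  -- Symmetry of second partials removes every second derivative of the frame from dβ.
  have e1 := pd_comm s1 0 1
  have e2 := pd_comm s2 0 1
  have w1 := Om_swap p k (X y) (pd 1 (push X e₁) y) (pd 0 (push X e₁) y)
  have w2 := Om_swap p k (X y) (pd 1 (push X e₂) y) (pd 0 (push X e₂) y)
  rw [key, key, e1, e2]
  simp only [Om_eq, G_add_right] at w1 w2 ⊢
  simp only [G_comm p _ (J p k _ _)] at w1 w2 ⊢
  linear_combination w1 + ε * w2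

/-- The divergence of a rotated 1-form is its curl; the factor `coordDet` evaluates dβ on (e₁, e₂).
-/
lemma MinimalPatch.laplacian_eq (hb : b * b = 1) (hy : y ∈ W) (k : Fin 2) :
    laplacian p X (C k) y = coordDet (e₁ y) (e₂ y) *
      (-ε * (pd 0 (dualForm p ε X (C k) e₁ e₂ k 1) y
        - pd 1 (dualForm p ε X (C k) e₁ e₂ k 0) y)) := by
  have s1 := hM.contDiffAt_push hy (hM.smooth_e₁ hf hy)
  have s2 := hM.contDiffAt_push hy (hM.smooth_e₂ hf hy)
  have sβ : ∀ j, DifferentiableAt ℝ (dualForm p ε X (C k) e₁ e₂ k j) y := fun j => by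
    refine ContDiffAt.differentiableAt (n := ∞) ?_ (by simp)
    exact (contDiffAt_const.mul ((hM.contDiffAt_kahler hf hy k).mul
      (contDiffAt_G (contDiffAt_pd s1 j) s2))).sub
        ((contDiffAt_G (contDiffAt_pd s1 j) (contDiffAt_J (hM.smooth y hy) s1)).add
          (contDiffAt_const.mul
            (contDiffAt_G (contDiffAt_pd s2 j) (contDiffAt_J (hM.smooth y hy) s2))))
  rw [laplacian, Fin.sum_univ_two, sqrt_det_gram hM.hε (hf.oriented y hy), inv_inv,
    hM.pd_congr_on hy (fun z hz => (hM.sqrt_mul_grad hf hb hz k).1),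
    hM.pd_congr_on hy (fun z hz => (hM.sqrt_mul_grad hf hb hz k).2), pd_neg,
    pd_const_mul _ (sβ 1), pd_const_mul _ (sβ 0)]
  ring

/-- The Laplacian of the Kähler function in terms of the second fundamental form. -/
lemma MinimalPatch.laplacian_frame (hb : b * b = 1) (hy : y ∈ W) (k : Fin 2) :
    laplacian p X (C k) y =
      4 * Om p k (X y) (N y) (N' y) *
          (G p (fderiv ℝ (push X e₁) y (e₁ y)) (N y) * G p (fderiv ℝ (push X e₂) y (e₁ y)) (N' y)
            - G p (fderiv ℝ (push X e₁) y (e₁ y)) (N' y)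
              * G p (fderiv ℝ (push X e₂) y (e₁ y)) (N y))
        + 2 * ε * C k y * (ε * gaussCurvature p X y)
        - ε * ((-1) ^ p * (C 0 y * C 1 y) * C k y + ε * C (1 - k) y) := by
  obtain ⟨r, s, h⟩ := hM.adaptedPoint hf hb hy
  have d := hM.frameDerivative hf hy
  have hL := h.laplacian_identity d k
  rw [← hM.fderiv_kahler hf hy k (e₁ y), ← hM.fderiv_kahler hf hy k (e₂ y),
    ← hM.gauss hf hb hy] at hL
  rw [hM.laplacian_eq hf hb hy, hM.d_dualForm hf hy, ← hL]
  simp only [Om_push_base]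
  simp only [fderiv_eq_sum_pd _ (e₁ y), fderiv_eq_sum_pd _ (e₂ y), Om_add_left, Om_add_right,
    Om_smul_left, Om_smul_right, G_add_left, G_add_right, G_smul_left, G_smul_right, Om_self,
    Om_swap p k (X y) (pd 1 (push X e₁) y) (pd 0 (push X e₁) y),
    Om_swap p k (X y) (pd 1 (push X e₂) y) (pd 0 (push X e₂) y), coordDet]
  ring

end Patch

section Patch

variable {p : ℕ} {ε b : ℝ} {X : Coord → Amb} {C : Fin 2 → Coord → ℝ} {W : Set Coord}
  {e₁ e₂ : Coord → Coord} {N N' : Coord → Amb} {y : Coord}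
  (hM : MinimalPatch p ε X C W) (hf : IsAdaptedFrame p ε b X C W e₁ e₂ N N')

/-! ### Orientation of the normal frame and the main identities -/

include hM hf

/-- Where the normal parts of `J_1 E₁` and `J_2 E₁` vanish on an open set, the surface lies in a
slice of the product and is totally geodesic. -/
lemma MinimalPatch.secondFF_eq_zero (hy : y ∈ W)
    (h : ∀ᶠ z in nhds y, ∃ r s : Fin 2 → ℝ, AdaptedPoint p ε b (X z) (push X e₁ z) (push X e₂ z)
      (N z) (N' z) (fun k => C k z) r s ∧ (∀ k, r k = 0) ∧ ∀ k, s k = 0) :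
    G p (fderiv ℝ (push X e₁) y (e₁ y)) (N y) = 0
      ∧ G p (fderiv ℝ (push X e₁) y (e₁ y)) (N' y) = 0 := by
  -- With r_k = s_k = 0, `normal_norm` gives C_k² = ε(-1)^p for both k.
  have hC : ∀ᶠ z in nhds y, (C 0 z * C 1 z) ^ 2 = 1 ∧ C 0 z ^ 2 = C 1 z ^ 2 ∧ C 0 z ≠ 0 := by
    filter_upwards [h] with z hz
    obtain ⟨r, s, hz, hr, hs⟩ := hz
    have n0 := hz.normal_norm 0
    have n1 := hz.normal_norm 1
    rw [hr, hs] at n0 n1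
    have hε := hM.hε
    have hp := neg_one_pow_mul_self p
    have e0 : C 0 z ^ 2 = ε * (-1) ^ p := by linear_combination ε * n0 - C 0 z ^ 2 * hε
    have e1 : C 1 z ^ 2 = ε * (-1) ^ p := by linear_combination ε * n1 - C 1 z ^ 2 * hε
    refine ⟨?_, by rw [e0, e1], ?_⟩
    · rw [mul_pow, e0, e1]
      linear_combination (-1) ^ p * (-1) ^ p * hε + hp
    · intro h0
      rw [h0] at e0
      have hε0 : ε ≠ 0 := by rintro rfl; simp at hε
      have hp0 : ((-1 : ℝ)) ^ p ≠ 0 := by positivity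
      apply mul_ne_zero hε0 hp0
      rw [← e0]; norm_num
  have hcont : ContinuousAt (fun z => C 0 z * C 1 z) y :=
    (hM.contDiffAt_kahler hf hy 0).continuousAt.mul (hM.contDiffAt_kahler hf hy 1).continuousAt
  -- The continuous function C 0 * C 1 does not vanish, so its sign is locally constant. The sign
  -- selects the factor to which the surface is tangent; E₁ and its derivatives stay in that factor,
  -- while N and N' lie in the other.
  have hsign : (∀ᶠ z in nhds y, C 1 z = C 0 z) ∨ ∀ᶠ z in nhds y, C 1 z = -C 0 z := by
    have hne : C 0 y * C 1 y ≠ 0 := by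
      intro h0
      have := hC.self_of_nhds.1
      rw [h0] at this
      norm_num at this
    rcases lt_or_gt_of_ne hne with hlt | hgt
    · right
      filter_upwards [hC, hcont.eventually_lt continuousAt_const hlt] with z hz hlt
      rcases sq_eq_sq_iff_eq_or_eq_neg.1 hz.2.1 with h1 | h1
      · rw [h1] at hlt; nlinarith
      · linarith
    · left
      filter_upwards [hC, continuousAt_const.eventually_lt hcont hgt] with z hz hgt
      rcases sq_eq_sq_iff_eq_or_eq_neg.1 hz.2.1 with h1 | h1
      · linarith
      · rw [h1] at hgt; nlinarith
  have d1 : DifferentiableAt ℝ (push X e₁) y :=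
    (hM.contDiffAt_push hy (hM.smooth_e₁ hf hy)).differentiableAt (by simp)
  have z0 : ∀ a, ip p 0 a = 0 := fun a => by simp [← ipBilin_apply]
  have z0' : ∀ a, ip p a 0 = 0 := fun a => by simp [← ipBilin_apply]
  obtain ⟨r, s, hy', -, -⟩ := h.self_of_nhds
  rcases hsign with hsgn | hsgn
  · have hE : ∀ᶠ z in nhds y, (push X e₁ z).2 = 0 ∧ (push X e₂ z).2 = 0 := by
      filter_upwards [h, hsgn] with z hz hs
      obtain ⟨r, s, hz, hr, hs'⟩ := hz
      exact hz.snd_eq_zero hr hs' hs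
    have hU : ∀ i, (pd i (push X e₁) y).2 = 0 := fun i => by
      rw [← pd_snd d1, pd_congr (hE.mono fun z hz => hz.1), pd_const]
    have hU' : (fderiv ℝ (push X e₁) y (e₁ y)).2 = 0 := by
      rw [fderiv_eq_sum_pd, Prod.snd_add, Prod.smul_snd, Prod.smul_snd, hU, hU]; simp
    have hN := hy'.orthogonal_fst_eq_zero hE.self_of_nhds.1 hE.self_of_nhds.2 hy'.N_fst
      hy'.E₁_N hy'.E₂_N
    have hN' := hy'.orthogonal_fst_eq_zero hE.self_of_nhds.1 hE.self_of_nhds.2 hy'.N'_fst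
      hy'.E₁_N' hy'.E₂_N'
    simp [G, hU', hN, hN', z0, z0']
  · have hE : ∀ᶠ z in nhds y, (push X e₁ z).1 = 0 ∧ (push X e₂ z).1 = 0 := by
      filter_upwards [h, hsgn] with z hz hs
      obtain ⟨r, s, hz, hr, hs'⟩ := hz
      exact hz.fst_eq_zero hr hs' hs
    have hU : ∀ i, (pd i (push X e₁) y).1 = 0 := fun i => by
      rw [← pd_fst d1, pd_congr (hE.mono fun z hz => hz.1), pd_const]
    have hU' : (fderiv ℝ (push X e₁) y (e₁ y)).1 = 0 := by
      rw [fderiv_eq_sum_pd, Prod.fst_add, Prod.smul_fst, Prod.smul_fst, hU, hU]; simp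
    have hN := hy'.orthogonal_snd_eq_zero hE.self_of_nhds.1 hE.self_of_nhds.2 hy'.N_snd
      hy'.E₁_N hy'.E₂_N
    have hN' := hy'.orthogonal_snd_eq_zero hE.self_of_nhds.1 hE.self_of_nhds.2 hy'.N'_snd
      hy'.E₁_N' hy'.E₂_N'
    simp [G, hU', hN, hN', z0, z0']

/-- The value of `Ω_k` on the normal frame, against the normal curvature. -/
lemma MinimalPatch.Om_normal_mul (hb : b * b = 1) (hy : y ∈ W) (k : Fin 2) :
    (Om p k (X y) (N y) (N' y) - (-1) ^ (k : ℕ) * b * C k y)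
      * (G p (fderiv ℝ (push X e₁) y (e₁ y)) (N y) * G p (fderiv ℝ (push X e₂) y (e₁ y)) (N' y)
        - G p (fderiv ℝ (push X e₁) y (e₁ y)) (N' y)
          * G p (fderiv ℝ (push X e₂) y (e₁ y)) (N y)) = 0 := by
  by_cases h0 : Om p k (X y) (N y) (N' y) - (-1) ^ (k : ℕ) * b * C k y = 0
  · rw [h0, zero_mul]
  have hcont : ContinuousAt (fun z => Om p k (X z) (N z) (N' z) - (-1) ^ (k : ℕ) * b * C k z) y := by
    simp only [Om_eq]
    exact ((contDiffAt_G (contDiffAt_J (hM.smooth y hy) (hM.smooth_N hf hy))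
      (hM.smooth_N' hf hy)).continuousAt).sub
        (continuousAt_const.mul (hM.contDiffAt_kahler hf hy k).continuousAt)
  -- If the difference is nonzero at y, it is nonzero nearby by continuity, and `Om_normal` then
  -- excludes nonzero normal parts throughout a neighbourhood.
  obtain ⟨h1, h2⟩ := hM.secondFF_eq_zero hf hy (by
    filter_upwards [hcont.eventually_ne h0, hM.eventually hy (fun z hz => hz)] with z hne hz
    obtain ⟨r, s, h⟩ := hM.adaptedPoint hf hb hz
    refine ⟨r, s, h, ?_⟩
    by_contra hcon
    apply hne
    rw [h.Om_normal ?_ k, sub_self]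
    by_contra hall
    push Not at hall
    exact hcon ⟨fun k => (hall k).1, fun k => (hall k).2⟩)
  rw [h1, h2]; ring

theorem MinimalPatch.kahler_identities (hb : b * b = 1) (hy : y ∈ W) (j : Fin 2) :
    gradNormSq p X (C j) y =
        (ε * C j y ^ 2 + (-1) ^ (p + 1)) *
          (ε * gaussCurvature p X y
            + ε * b * (-1) ^ (j : ℕ) * normalCurvature p X e₁ e₂ N N' y
            + (-1) ^ (p + 1) * (C j y * C (1 - j) y)) ∧
      laplacian p X (C j) y =
        2 * ε * C j y *
            (ε * gaussCurvature p X y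
              + ε * b * (-1) ^ (j : ℕ) * normalCurvature p X e₁ e₂ N N' y)
          - C (1 - j) y * (1 - ε * (-1) ^ (p + 1) * C j y ^ 2) := by
  obtain ⟨r, s, h⟩ := hM.adaptedPoint hf hb hy
  have d := hM.frameDerivative hf hy
  have hε := hM.hε
  have hCC : C 0 y * C 1 y = C j y * C (1 - j) y := by
    fin_cases j
    · rfl
    · exact mul_comm _ _
  constructor
  · rw [hM.gradNormSq_eq hf hy, h.gradient_identity d j, hM.gauss hf hb hy,
      hM.normalCurvature_eq hf hy, hCC, pow_succ]
    ring
  -- Since K^⊥ = 2(fg' - f'g), this turns the term 4 Ω_j(N, N')(fg' - f'g) into 2εC_j times εb(-1)^j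
  -- K^⊥.
  · have hO := hM.Om_normal_mul hf hb hy j
    rw [hM.laplacian_frame hf hb hy, hM.normalCurvature_eq hf hy, hCC, pow_succ]
    linear_combination 4 * hO - C (1 - j) y * hε
      - 4 * b * (-1) ^ (j : ℕ) * C j y *
        (G p (fderiv ℝ (push X e₁) y (e₁ y)) (N y) * G p (fderiv ℝ (push X e₂) y (e₁ y)) (N' y)
        - G p (fderiv ℝ (push X e₁) y (e₁ y)) (N' y)
          * G p (fderiv ℝ (push X e₂) y (e₁ y)) (N y)) * hε

end Patch

/-- The restriction of a minimal immersion to an open part of an oriented chart. -/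
lemma IsMinimalImmersion.minimalPatch {S : Type*} [TopologicalSpace S] [ChartedSpace Coord S]
    [IsManifold (𝓡 2) ∞ S] {A : OrientedAtlas S} {p : ℕ} {ε : ℝ} {F : S → Amb} (hp : p ≤ 2)
    (hε : ε * ε = 1) (hF : IsMinimalImmersion A p ε F)
    {C : Fin 2 → S → ℝ} (hC : ∀ k, IsKahlerFunction A p ε F k (C k))
    {φ : OpenPartialHomeomorph S Coord} (hφ : φ ∈ A.charts) {W : Set Coord} (hWo : IsOpen W)
    (hW : W ⊆ φ.target) :
    MinimalPatch p ε (F ∘ φ.symm) (fun k => C k ∘ φ.symm) W where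
  hp := hp
  hε := hε
  isOpen := hWo
  smooth := fun y hy => by
    have h1 : ContMDiffOn (𝓡 2) (𝓡 2) ∞ φ.symm φ.target :=
      contMDiffOn_symm_of_mem_maximalAtlas (A.smooth hφ)
    have h2 : ContMDiffAt (𝓡 2) (𝓡 2) ∞ φ.symm y :=
      h1.contMDiffAt (φ.open_target.mem_nhds (hW hy))
    have h3 : ContMDiffAt (𝓡 2) 𝓘(ℝ, Amb) ∞ (F ∘ φ.symm) y := hF.smooth.contMDiffAt.comp y h2
    exact contMDiffAt_iff_contDiffAt.1 h3
  mem := fun y _ => hF.mem _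
  minimal := fun y hy => hF.minimal φ hφ y (hW hy)
  kahler := fun y hy k a c => hC k φ hφ y (hW hy) a c

end NeutralProduct

theorem proposition10 (p : ℕ) (hp : p ≤ 2) (ε b : ℝ) (hε : ε = 1 ∨ ε = -1)
    (hb : b = 1 ∨ b = -1)
    {S : Type*} [TopologicalSpace S] [ChartedSpace Coord S] [IsManifold (𝓡 2) ∞ S]
    (A : OrientedAtlas S)
    -- the minimal immersion and its Kähler functions; the index `0, 1` stands for `1, 2`
    (F : S → Amb) (hF : IsMinimalImmersion A p ε F)
    (C : Fin 2 → S → ℝ) (hC : ∀ k, IsKahlerFunction A p ε F k (C k))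
    -- a local adapted frame over an open subset of an oriented chart
    (φ : OpenPartialHomeomorph S Coord) (hφ : φ ∈ A.charts)
    (W : Set Coord) (hWo : IsOpen W) (hW : W ⊆ φ.target)
    (e₁ e₂ : Coord → Coord) (N N' : Coord → Amb)
    (hframe : IsAdaptedFrame p ε b (F ∘ φ.symm) (fun k => C k ∘ φ.symm) W e₁ e₂ N N')
    (j : Fin 2) (x : Coord) (hx : x ∈ W) :
    gradNormSq p (F ∘ φ.symm) (C j ∘ φ.symm) x =
        (ε * C j (φ.symm x) ^ 2 + (-1) ^ (p + 1)) *
          (ε * gaussCurvature p (F ∘ φ.symm) x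
            + ε * b * (-1) ^ (j : ℕ) * normalCurvature p (F ∘ φ.symm) e₁ e₂ N N' x
            + (-1) ^ (p + 1) * (C j (φ.symm x) * C (1 - j) (φ.symm x))) ∧
      laplacian p (F ∘ φ.symm) (C j ∘ φ.symm) x =
        2 * ε * C j (φ.symm x) *
            (ε * gaussCurvature p (F ∘ φ.symm) x
              + ε * b * (-1) ^ (j : ℕ) * normalCurvature p (F ∘ φ.symm) e₁ e₂ N N' x)
          - C (1 - j) (φ.symm x) * (1 - ε * (-1) ^ (p + 1) * C j (φ.symm x) ^ 2) := by
  have hε' : ε * ε = 1 := by rcases hε with rfl | rfl <;> norm_num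
  have hb' : b * b = 1 := by rcases hb with rfl | rfl <;> norm_num
  exact (hF.minimalPatch hp hε' hC hφ hWo hW).kahler_identities hframe hb' hx j
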